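/- Let $d\in\mathbb N$ and let $p\in C^\infty(\mathbb R^{2d},\mathbb C)$ be bounded together with all its derivatives. Assume that $\operatorname{Re}p\ge 0$, that $\operatorname{Re}p$ vanishes exactly at the origin, that $\liminf_{|(x,\xi)|\to\infty}\operatorname{Re}p(x,\xi)>0$, and that $p(0,0)=0$, $p'(0,0)=0$. Let $q:\mathbb R^{2d}\to\mathbb C$ be the quadratic form with $p(x,\xi)-q(x,\xi)=O(|(x,\xi)|^3)$ as $(x,\xi)\to 0$, and assume that $\operatorname{Re}q$ is elliptic, i.e. $\operatorname{Re}q(x,\xi)=0$ only for $(x,\xi)=0$. Let $\Phi_0(x)=\frac12|\operatorname{Im}x|^2$ on $\mathbb C^d$, let $dL$ be Lebesgue measure on $\mathbb C^d$, and for $h>0$ let $L^2_{\Phi_0}(\mathbb C^d;h)=L^2(\mathbb C^d;e^{-2\Phi_0(x)/h}\,dL(x))$ and $H_{\Phi_0}(\mathbb C^d;h)=\operatorname{Hol}(\mathbb C^d)\cap L^2_{\Phi_0}(\mathbb C^d;h)$, with the same norm. Let $\kappa_T(y,\eta)=(y-i\eta,\eta)$, a bijection of $\mathbb R^{2d}$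 onto $\Lambda_{\Phi_0}=\{(x,\frac2i\partial_x\Phi_0(x))\}=\{(x,-\operatorname{Im}x):x\in\mathbb C^d\}$, and let $\mathfrak p=p\circ\kappa_T^{-1}$, $\mathfrak q=q\circ\kappa_T^{-1}$ on $\Lambda_{\Phi_0}$. For a function $\mathfrak a$ on $\Lambda_{\Phi_0}$, let $\mathfrak a^w=\mathfrak a^w(x,hD_x)$ be its Weyl quantization $$\mathfrak a^w u(x)=\frac1{(2\pi h)^d}\iint_{\Gamma_0(x)}e^{\frac ih(x-y)\cdot\theta}\,\mathfrak a\Big(\frac{x+y}2,\theta\Big)u(y)\,dy\,d\theta,\qquad \Gamma_0(x)=\Big\{\theta=\frac2i\frac{\partial\Phi_0}{\partial x}\Big(\frac{x+y}2\Big)=-\operatorname{Im}\frac{x+y}2\Big\},$$ where on $\Gamma_0(x)$ one has $dy\,d\theta=2^{-d}dL(y)$, and the integral is an oscillatory one: it is the limit, as $\delta\to0^+$, of the integrals with the additional factor $\chi(\delta(x-y))$, for every $\chi\in C_0^\infty(\mathbb C^d)$ equal to $1$ near $0$. Then there is a constant $C>0$, depending only on $d$, $p$ and $q$, such that for all $0<h\le1$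 and all $u\in H_{\Phi_0}(\mathbb C^d;h)$ the functions $\mathfrak p^wu$ and $\mathfrak q^wu$ are well defined at every point of $\mathbb C^d$ and, for all $\varepsilon\ge h^{1/2}$, the function $\mathbf 1_{\{|x|\le\varepsilon\}}(\mathfrak p^w-\mathfrak q^w)u$ belongs to $L^2_{\Phi_0}(\mathbb C^d;h)$ and $$\big\|\mathbf 1_{\{|x|\le\varepsilon\}}(\mathfrak p^w-\mathfrak q^w)u\big\|_{L^2_{\Phi_0}(\mathbb C^d;h)}\le C\,\varepsilon^3\,\|u\|_{H_{\Phi_0}(\mathbb C^d;h)}.$$ -/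

import Mathlib

open MeasureTheory Filter Topology Set
open scoped ContDiff

namespace Bargmann

noncomputable section

/-- Configuration space `ℝ^d` with its Euclidean norm. -/
abbrev RSpace (d : ℕ) : Type := EuclideanSpace ℝ (Fin d)

/-- The space `ℂ^d` with its Hermitian norm; its `volume` is Lebesgue measure `dL` on
`ℝ^d_{Re x} × ℝ^d_{Im x}`. -/
abbrev CSpace (d : ℕ) : Type := EuclideanSpace ℂ (Fin d)

/-! ### Symbols on the real side -/

/-- The symbol class `S(1)`: smooth functions on `ℝ^{2d}` bounded together with all derivatives. -/
def IsSymbolS1 {d : ℕ} (a : RSpace d × RSpace d → ℂ) : Prop :=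
  ContDiff ℝ ∞ a ∧ ∀ k : ℕ, ∃ C : ℝ, ∀ X, ‖iteratedFDeriv ℝ k a X‖ ≤ C

/-- Ellipticity of a (complex-valued) quadratic form on `ℝ^{2d}`: it vanishes only at the origin and
its range is not all of `ℂ`. -/
def IsEllipticForm {d : ℕ} (q : RSpace d × RSpace d → ℂ) : Prop :=
  (∀ X, q X = 0 ↔ X = 0) ∧ range q ≠ univ

/-- The hypotheses on a symbol `p` and its quadratic part `q` at the doubly characteristic
point `0`. -/
structure IsDoublyCharacteristic {d : ℕ} (p : RSpace d × RSpace d → ℂ)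
    (q : QuadraticMap ℝ (RSpace d × RSpace d) ℂ) : Prop where
  symbol : IsSymbolS1 p
  re_nonneg : ∀ X, 0 ≤ (p X).re
  re_eq_zero_iff : ∀ X, (p X).re = 0 ↔ X = 0
  /-- The lower limit of `Re p` at infinity is positive. -/
  elliptic_at_infinity : ∃ c : ℝ, 0 < c ∧ ∀ᶠ X in cocompact (RSpace d × RSpace d), c ≤ (p X).re
  value_zero : p 0 = 0
  deriv_zero : fderiv ℝ p 0 = 0
  quadratic_part : (fun X => p X - q X) =O[𝓝 0] fun X => ‖X‖ ^ 3
  re_elliptic : IsEllipticForm fun X => ((q X).re : ℂ)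

/-! ### The Bargmann side -/

/-- The coordinatewise real part. -/
def reVec {d : ℕ} (x : CSpace d) : RSpace d := WithLp.toLp 2 fun j => (x j).re

/-- The coordinatewise imaginary part. -/
def imVec {d : ℕ} (x : CSpace d) : RSpace d := WithLp.toLp 2 fun j => (x j).im

/-- The inclusion of `ℝ^d` in `ℂ^d`. -/
def ofRealVec {d : ℕ} (y : RSpace d) : CSpace d := WithLp.toLp 2 fun j => (y j : ℂ)

/-- The weight `Φ₀(x) = (Im x)² / 2` of the Bargmann transform with phase `i (x - y)² / 2`. -/
def Phi0 {d : ℕ} (x : CSpace d) : ℝ := ‖imVec x‖ ^ 2 / 2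

/-- `ξ(x) = (2/i) ∂Φ₀/∂x (x) = - Im x`. -/
def xi0 {d : ℕ} (x : CSpace d) : CSpace d := ofRealVec (-imVec x)

/-- The manifold `Λ_{Φ₀} = {(x, (2/i) ∂Φ₀/∂x (x))}` in `ℂ^{2d}`. -/
def Lambda0 (d : ℕ) : Set (CSpace d × CSpace d) := {Z | Z.2 = xi0 Z.1}

/-- The canonical transformation `κ_T (y, η) = (y - i η, η)`, on real phase space. -/
def kappaT {d : ℕ} (Y : RSpace d × RSpace d) : CSpace d × CSpace d :=
  (ofRealVec Y.1 - Complex.I • ofRealVec Y.2, ofRealVec Y.2)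

/-- The inverse `(x, ξ) ↦ (x + i ξ, ξ)` of `κ_T`. On `Λ_{Φ₀}` both components are real, and taking
real parts only turns them into elements of `ℝ^d`. -/
def kappaTInv {d : ℕ} (Z : CSpace d × CSpace d) : RSpace d × RSpace d :=
  (reVec (Z.1 + Complex.I • Z.2), reVec Z.2)

theorem kappaTInv_kappaT {d : ℕ} (Y : RSpace d × RSpace d) : kappaTInv (kappaT Y) = Y := by
  ext j <;> simp [kappaTInv, kappaT, reVec, ofRealVec]

theorem kappaT_kappaTInv {d : ℕ} {Z : CSpace d × CSpace d} (hZ : Z ∈ Lambda0 d) :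
    kappaT (kappaTInv Z) = Z := by
  obtain ⟨x, ξ⟩ := Z
  have hξ : ξ = xi0 x := hZ
  subst hξ
  ext j <;> simp [kappaTInv, kappaT, reVec, ofRealVec, xi0, imVec, Complex.ext_iff]

theorem kappaT_mem {d : ℕ} (Y : RSpace d × RSpace d) : kappaT Y ∈ Lambda0 d := by
  show (kappaT Y).2 = xi0 (kappaT Y).1
  ext j
  simp [kappaT, ofRealVec, xi0, imVec]

/-- The symbol `a ∘ κ_T⁻¹` on `Λ_{Φ₀}` (only its values on `Λ_{Φ₀}` matter). -/
def fbiSymbol {d : ℕ} (a : RSpace d × RSpace d → ℂ) (Z : CSpace d × CSpace d) : ℂ :=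
  a (kappaTInv Z)

/-- The measure `e^{-2 Φ₀(x)/h} dL(x)`; thus `L²_{Φ₀}(ℂ^d; h)` is `L²` of this measure, and its norm
is `eLpNorm · 2 (weightedMeasure d h)`. -/
def weightedMeasure (d : ℕ) (h : ℝ) : Measure (CSpace d) :=
  volume.withDensity fun x => ENNReal.ofReal (Real.exp (-(2 / h) * Phi0 x))

/-- Membership in `H_{Φ₀}(ℂ^d; h)`: entire functions that belong to `L²_{Φ₀}(ℂ^d; h)`. -/
def MemH {d : ℕ} (h : ℝ) (u : CSpace d → ℂ) : Prop :=
  Differentiable ℂ u ∧ MemLp u 2 (weightedMeasure d h)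

/-- Cutoff functions: smooth, compactly supported, equal to `1` near the origin. -/
def IsCutoff {d : ℕ} (χ : CSpace d → ℂ) : Prop :=
  ContDiff ℝ ∞ χ ∧ HasCompactSupport χ ∧ ∀ᶠ x in 𝓝 0, χ x = 1

/-- On the contour `Γ₀(x)`: `θ = (2/i) ∂Φ₀/∂x ((x + y)/2)`. -/
def contourTheta {d : ℕ} (x y : CSpace d) : CSpace d := xi0 ((1 / 2 : ℂ) • (x + y))

/-- The integral
`(2 π h)^{-d} ∬_{Γ₀(x)} e^{i (x - y)·θ / h} χ(δ (x - y)) a((x + y)/2, θ) u(y) dy dθ`.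
With `x` fixed, `θ_j = - Im (x_j + y_j) / 2` on `Γ₀(x)`, so that for the (positive) orientation of the
contour `dy dθ = 2^{-d} dL(y)`. -/
def truncatedWeyl {d : ℕ} (h : ℝ) (a : CSpace d × CSpace d → ℂ) (u : CSpace d → ℂ)
    (χ : CSpace d → ℂ) (δ : ℝ) (x : CSpace d) : ℂ :=
  ((2 * Real.pi * h : ℝ) : ℂ)⁻¹ ^ d *
    ∫ y : CSpace d,
      Complex.exp (Complex.I / (h : ℂ) * ∑ j, (x j - y j) * contourTheta x y j) *
        χ ((δ : ℂ) • (x - y)) * a ((1 / 2 : ℂ) • (x + y), contourTheta x y) * u y *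
        (1 / 2 : ℂ) ^ d

/-- `IsWeyl h a u v` says that `v = a^w(x, h D_x) u`, the Weyl quantization along `Γ₀(x)` being
understood as an oscillatory integral: at every point, for every cutoff `χ`, the integrals truncated
by `χ(δ (x - y))` converge to `v x` as `δ → 0⁺`. -/
def IsWeyl {d : ℕ} (h : ℝ) (a : CSpace d × CSpace d → ℂ) (u v : CSpace d → ℂ) : Prop :=
  ∀ χ : CSpace d → ℂ, IsCutoff χ → ∀ x : CSpace d,
    Tendsto (fun δ : ℝ => truncatedWeyl h a u χ δ x) (𝓝[>] 0) (𝓝 (v x))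

end

end Bargmann

/-!
With `t = h^{1/2}`, the substitution `y = x + 2 t s` turns the truncated integrals into
`π^{-d} ∫ b(s) G(s) ds`. Here `b(s)` is a cutoff times the symbol at `κ_T⁻¹` of the midpoint
`x + t s` (`amplitude`), and `G` (`weylFactor`) is the oscillating factor times `u(x + 2 t s)`. The
modulus of `G` is `e^{Φ₀(x)/h}` times `e^{-Φ₀/h} |u|` at `x + 2 t s`, so it has no decay in `s`.

Decay comes from integrating by parts with the operator `Z = ∑ⱼ s̄ⱼ ∂/∂s̄ⱼ` (`dbarEuler`). As `u` is
holomorphic, `Z` only sees the phase, and `Z G = -|s|² G`; hence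
`∫ (Z f + (d + 1) f) G = ∫ (1 + |s|²) f G` for `f` of compact support. Equivalently `b` may be
replaced by `T b = (Z + d + 1) ((1 + |s|²)⁻¹ b)` (`transOp`). Since `Z` acts on `v = (1 + |s|²)⁻¹` by
`Z v = v² - v`, every application of `T` gains a factor `v`, while `Z` itself costs nothing but
powers of `1 + |s|`, compensated by the number of applications. For symbols with
`t^k ‖a⁽ᵏ⁾(X)‖ ≤ A (t + |X|)³` (`ScaledBound`), the iterate `T^{2d+4} b` is bounded by
`A (t + |x|)³ (1 + |s|)^{-(2d+1)}`, uniformly in the cutoff (`exists_norm_iterate_amplitude_le`).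
Dominated convergence then yields the oscillatory integrals (`isWeyl_weylValue`), and Young's
inequality bounds them in `L²_{Φ₀}`, on the ball `|x| ≤ ε` with `t ≤ ε`, by a constant times
`A ε³ ‖u‖` (`exists_eLpNorm_indicator_weylValue_le`).

The difference `p - q` vanishes to third order at the origin, and its derivatives of order at least
three are those of `p`, hence bounded. It therefore satisfies the scaled bounds with `A` independent
of `t ≤ 1` (`IsDoublyCharacteristic.exists_scaled_bound_sub`).
-/

namespace Bargmann

noncomputable section

/-! ### The antiholomorphic Euler operator -/

/-- The operator `∑ⱼ s̄ⱼ ∂/∂s̄ⱼ` on functions of `s ∈ ℂ^d`, in the coordinate-free form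
`(Df(s)(s) + i Df(s)(i s)) / 2`. -/
def dbarEuler {d : ℕ} (f : CSpace d → ℂ) (s : CSpace d) : ℂ :=
  1 / 2 * (fderiv ℝ f s s + Complex.I * fderiv ℝ f s (Complex.I • s))

/-- Multiplication by `i` on `ℂ^d`, as a real-linear map. -/
def mulI (d : ℕ) : CSpace d →L[ℝ] CSpace d :=
  LinearMap.mkContinuous
    { toFun := fun s => Complex.I • s
      map_add' := fun a b => smul_add _ a b
      map_smul' := fun r a => by ext j; simp; ring } 1 (fun s => by simp [norm_smul])

theorem norm_mulI_le (d : ℕ) : ‖mulI d‖ ≤ 1 := LinearMap.mkContinuous_norm_le _ zero_le_one _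

theorem contDiff_dbarEuler {d : ℕ} {f : CSpace d → ℂ} (hf : ContDiff ℝ ∞ f) :
    ContDiff ℝ ∞ (dbarEuler f) := by
  have h1 : ContDiff ℝ ∞ (fderiv ℝ f) := hf.fderiv_right (by simp)
  have h2 : ContDiff ℝ ∞ fun s => fderiv ℝ f s s := h1.clm_apply contDiff_id
  have h3 : ContDiff ℝ ∞ fun s => fderiv ℝ f s (mulI d s) := h1.clm_apply (mulI d).contDiff
  exact contDiff_const.mul (h2.add (contDiff_const.mul h3))

theorem dbarEuler_add {d : ℕ} {f g : CSpace d → ℂ} {s : CSpace d} (hf : DifferentiableAt ℝ f s)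
    (hg : DifferentiableAt ℝ g s) :
    dbarEuler (fun t => f t + g t) s = dbarEuler f s + dbarEuler g s := by
  simp only [dbarEuler, fderiv_fun_add hf hg, _root_.add_apply]
  ring

theorem dbarEuler_const_mul {d : ℕ} {f : CSpace d → ℂ} {s : CSpace d} (c : ℂ)
    (hf : DifferentiableAt ℝ f s) :
    dbarEuler (fun t => c * f t) s = c * dbarEuler f s := by
  simp only [dbarEuler, fderiv_const_mul hf, _root_.smul_apply, smul_eq_mul]
  ring

theorem dbarEuler_mul {d : ℕ} {f g : CSpace d → ℂ} {s : CSpace d} (hf : DifferentiableAt ℝ f s)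
    (hg : DifferentiableAt ℝ g s) :
    dbarEuler (fun t => f t * g t) s = dbarEuler f s * g s + f s * dbarEuler g s := by
  simp only [dbarEuler, fderiv_fun_mul hf hg, _root_.add_apply,
    _root_.smul_apply, smul_eq_mul]
  ring

theorem dbarEuler_congr {d : ℕ} {f g : CSpace d → ℂ} {s : CSpace d} (h : f =ᶠ[𝓝 s] g) :
    dbarEuler f =ᶠ[𝓝 s] dbarEuler g := by
  filter_upwards [h.fderiv (𝕜 := ℝ)] with t ht
  simp only [dbarEuler, ht]

theorem tsupport_dbarEuler_subset {d : ℕ} (f : CSpace d → ℂ) :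
    tsupport (dbarEuler f) ⊆ tsupport f := by
  refine closure_minimal (fun s hs => ?_) (isClosed_tsupport f)
  by_contra hc
  have h0 : f =ᶠ[𝓝 s] fun _ => 0 := notMem_tsupport_iff_eventuallyEq.mp hc
  apply hs
  have := (dbarEuler_congr h0).eq_of_nhds
  simpa [dbarEuler] using this

/-- The operator annihilates holomorphic functions. -/
theorem dbarEuler_of_differentiableAt {d : ℕ} {f : CSpace d → ℂ} {s : CSpace d}
    (hf : DifferentiableAt ℂ f s) : dbarEuler f s = 0 := by
  have h := hf.hasFDerivAt.restrictScalars ℝ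
  have h' : fderiv ℝ f s = (fderiv ℂ f s).restrictScalars ℝ := h.fderiv
  simp only [dbarEuler, h', ContinuousLinearMap.coe_restrictScalars', map_smul, smul_eq_mul]
  rw [← mul_assoc, Complex.I_mul_I]
  ring

/-! ### The weight and the transposed operator -/

/-- The weight `(1 + |s|²)⁻¹`. -/
def invWeight {d : ℕ} (s : CSpace d) : ℂ := (((1 + ‖s‖ ^ 2)⁻¹ : ℝ) : ℂ)

theorem one_add_norm_sq_pos {d : ℕ} (s : CSpace d) : 0 < 1 + ‖s‖ ^ 2 := by positivity

theorem contDiff_invWeight {d : ℕ} : ContDiff ℝ ∞ (invWeight (d := d)) := by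
  have h : ContDiff ℝ ∞ fun s : CSpace d => (1 + ‖s‖ ^ 2)⁻¹ :=
    (contDiff_const.add (contDiff_norm_sq ℝ)).inv fun s => (one_add_norm_sq_pos s).ne'
  exact Complex.ofRealCLM.contDiff.comp h

theorem norm_invWeight {d : ℕ} (s : CSpace d) : ‖invWeight s‖ = (1 + ‖s‖ ^ 2)⁻¹ := by
  rw [invWeight, Complex.norm_real, Real.norm_of_nonneg (by positivity)]

theorem norm_invWeight_le_one {d : ℕ} (s : CSpace d) : ‖invWeight s‖ ≤ 1 := by
  rw [norm_invWeight]
  exact inv_le_one_of_one_le₀ (by nlinarith [sq_nonneg ‖s‖])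

theorem re_inner_smul_I {d : ℕ} (s : CSpace d) : inner ℝ s (Complex.I • s) = 0 := by
  rw [PiLp.inner_apply]
  refine Finset.sum_eq_zero fun j _ => ?_
  simp [Complex.inner]
  ring

/-- On the radial weight the operator acts by a polynomial in the weight itself. -/
theorem dbarEuler_invWeight {d : ℕ} (s : CSpace d) :
    dbarEuler invWeight s = invWeight s * invWeight s - invWeight s := by
  have h1 : HasFDerivAt (fun s : CSpace d => 1 + ‖s‖ ^ 2) (2 • innerSL ℝ s) s := by
    simpa using! (hasStrictFDerivAt_norm_sq s).hasFDerivAt.const_add 1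
  have h2 := Complex.ofRealCLM.hasFDerivAt.comp s
    ((hasDerivAt_inv (one_add_norm_sq_pos s).ne').comp_hasFDerivAt s h1)
  have h3 : fderiv ℝ invWeight s = _ := h2.fderiv
  have h4 := (one_add_norm_sq_pos s).ne'
  have e1 : fderiv ℝ invWeight s s
      = ((-((1 + ‖s‖ ^ 2) ^ 2)⁻¹ * (2 * ‖s‖ ^ 2) : ℝ) : ℂ) := by
    rw [h3]
    simp
  have e2 : fderiv ℝ invWeight s (Complex.I • s) = 0 := by
    rw [h3]
    simp [re_inner_smul_I]
  rw [dbarEuler, e1, e2, invWeight]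
  norm_cast
  simp only [mul_zero, add_zero]
  norm_cast
  field_simp
  push_cast
  field_simp
  ring

/-- The transposed operator `f ↦ (∑ⱼ s̄ⱼ ∂/∂s̄ⱼ + d + 1) (f / (1 + |s|²))`: integrating `f` against a
function `G` with `∑ⱼ s̄ⱼ ∂G/∂s̄ⱼ = -|s|² G` amounts to integrating its image against `G`. -/
def transOp {d : ℕ} (f : CSpace d → ℂ) (s : CSpace d) : ℂ :=
  dbarEuler (fun t => invWeight t * f t) s + (d + 1) * (invWeight s * f s)

theorem contDiff_transOp {d : ℕ} {f : CSpace d → ℂ} (hf : ContDiff ℝ ∞ f) :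
    ContDiff ℝ ∞ (transOp f) :=
  (contDiff_dbarEuler (contDiff_invWeight.mul hf)).add
    (contDiff_const.mul (contDiff_invWeight.mul hf))

theorem contDiff_iterate_transOp {d : ℕ} {f : CSpace d → ℂ} (hf : ContDiff ℝ ∞ f) (n : ℕ) :
    ContDiff ℝ ∞ (transOp^[n] f) := by
  induction n with
  | zero => exact hf
  | succ n ih => rw [Function.iterate_succ_apply']; exact contDiff_transOp ih

theorem transOp_congr {d : ℕ} {f g : CSpace d → ℂ} {s : CSpace d} (h : f =ᶠ[𝓝 s] g) :
    transOp f =ᶠ[𝓝 s] transOp g := by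
  have h1 : (fun t => invWeight t * f t) =ᶠ[𝓝 s] fun t => invWeight t * g t := by
    filter_upwards [h] with t ht
    rw [ht]
  filter_upwards [dbarEuler_congr h1, h] with t ht ht'
  rw [transOp, transOp, ht, ht']

theorem iterate_transOp_congr {d : ℕ} {f g : CSpace d → ℂ} {s : CSpace d} (h : f =ᶠ[𝓝 s] g)
    (n : ℕ) : transOp^[n] f =ᶠ[𝓝 s] transOp^[n] g := by
  induction n with
  | zero => exact h
  | succ n ih => simpa only [Function.iterate_succ_apply'] using transOp_congr ih

theorem transOp_eq {d : ℕ} {f : CSpace d → ℂ} (hf : ContDiff ℝ ∞ f) :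
    transOp f = fun s => invWeight s * dbarEuler f s + d * (invWeight s * f s)
      + invWeight s * (invWeight s * f s) := by
  funext s
  rw [transOp, dbarEuler_mul (contDiff_invWeight.differentiable (by simp) s)
    (hf.differentiable (by simp) s), dbarEuler_invWeight]
  ring

theorem hasCompactSupport_transOp {d : ℕ} {f : CSpace d → ℂ} (hf : HasCompactSupport f) :
    HasCompactSupport (transOp f) := by
  have h1 : HasCompactSupport fun t => invWeight t * f t := hf.mul_left
  have h2 : HasCompactSupport (dbarEuler fun t => invWeight t * f t) :=
    h1.of_isClosed_subset (isClosed_tsupport _) (tsupport_dbarEuler_subset _)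
  exact h2.add h1.mul_left

theorem hasCompactSupport_iterate_transOp {d : ℕ} {f : CSpace d → ℂ} (hf : HasCompactSupport f)
    (n : ℕ) : HasCompactSupport (transOp^[n] f) := by
  induction n with
  | zero => exact hf
  | succ n ih => rw [Function.iterate_succ_apply']; exact hasCompactSupport_transOp ih

/-! ### Pointwise bounds for iterates of the transposed operator -/

/-- At the point `s`, the first `n` iterates of `∑ⱼ s̄ⱼ ∂/∂s̄ⱼ` on `f` are bounded by `B`. -/
def EulerBound {d : ℕ} (n : ℕ) (f : CSpace d → ℂ) (s : CSpace d) (B : ℝ) : Prop :=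
  ∀ k ≤ n, ‖dbarEuler^[k] f s‖ ≤ B

theorem EulerBound.succ_iff {d n : ℕ} {f : CSpace d → ℂ} {s : CSpace d} {B : ℝ} :
    EulerBound (n + 1) f s B ↔ ‖f s‖ ≤ B ∧ EulerBound n (dbarEuler f) s B := by
  constructor
  · intro h
    exact ⟨h 0 (by omega), fun k hk => h (k + 1) (by omega)⟩
  · rintro ⟨h0, h1⟩ k hk
    cases k with
    | zero => exact h0
    | succ k => exact h1 k (by omega)

theorem EulerBound.mono {d n m : ℕ} {f : CSpace d → ℂ} {s : CSpace d} {B B' : ℝ}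
    (h : EulerBound n f s B) (hm : m ≤ n) (hB : B ≤ B') : EulerBound m f s B' :=
  fun k hk => (h k (hk.trans hm)).trans hB

theorem EulerBound.add {d n : ℕ} {f g : CSpace d → ℂ} {s : CSpace d} {B B' : ℝ}
    (hfc : ContDiff ℝ ∞ f) (hgc : ContDiff ℝ ∞ g)
    (hf : EulerBound n f s B) (hg : EulerBound n g s B') :
    EulerBound n (fun t => f t + g t) s (B + B') := by
  induction n generalizing f g with
  | zero =>
    intro k hk
    obtain rfl : k = 0 := by omega
    exact (norm_add_le _ _).trans (add_le_add (hf 0 le_rfl) (hg 0 le_rfl))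
  | succ n ih =>
    rw [EulerBound.succ_iff] at hf hg ⊢
    refine ⟨(norm_add_le _ _).trans (add_le_add hf.1 hg.1), ?_⟩
    have e : dbarEuler (fun t => f t + g t) = fun t => dbarEuler f t + dbarEuler g t :=
      funext fun t => dbarEuler_add (hfc.differentiable (by simp) t)
        (hgc.differentiable (by simp) t)
    rw [e]
    exact ih (contDiff_dbarEuler hfc) (contDiff_dbarEuler hgc) hf.2 hg.2

theorem EulerBound.const_mul {d n : ℕ} {f : CSpace d → ℂ} {s : CSpace d} {B : ℝ} (c : ℂ)
    (hfc : ContDiff ℝ ∞ f) (hf : EulerBound n f s B) :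
    EulerBound n (fun t => c * f t) s (‖c‖ * B) := by
  induction n generalizing f with
  | zero =>
    intro k hk
    obtain rfl : k = 0 := by omega
    simpa using mul_le_mul_of_nonneg_left (hf 0 le_rfl) (norm_nonneg c)
  | succ n ih =>
    rw [EulerBound.succ_iff] at hf ⊢
    refine ⟨by simpa using mul_le_mul_of_nonneg_left hf.1 (norm_nonneg c), ?_⟩
    have e : dbarEuler (fun t => c * f t) = fun t => c * dbarEuler f t :=
      funext fun t => dbarEuler_const_mul c (hfc.differentiable (by simp) t)
    rw [e]
    exact ih (contDiff_dbarEuler hfc) hf.2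

/-- Multiplication by the weight gains a factor `(1 + |s|²)⁻¹` in all these bounds. -/
theorem exists_eulerBound_invWeight_mul (n : ℕ) :
    ∃ C : ℝ, 1 ≤ C ∧ ∀ {d : ℕ} {f : CSpace d → ℂ} {s : CSpace d} {B : ℝ}, ContDiff ℝ ∞ f →
      EulerBound n f s B →
        EulerBound n (fun t => invWeight t * f t) s (C * (‖invWeight s‖ * B)) := by
  induction n with
  | zero =>
    refine ⟨1, le_rfl, fun {d f s B} _ hf k hk => ?_⟩
    obtain rfl : k = 0 := by omega
    simpa using mul_le_mul_of_nonneg_left (hf 0 le_rfl) (norm_nonneg (invWeight s))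
  | succ n ih =>
    obtain ⟨C, hC, ih⟩ := ih
    refine ⟨C * (2 + C), by nlinarith, fun {d f s B} hfc hf => ?_⟩
    have hB0 : 0 ≤ B := (norm_nonneg _).trans (hf 0 (by omega))
    have hB : 0 ≤ ‖invWeight s‖ * B := mul_nonneg (norm_nonneg _) hB0
    have hfn := hf.mono (Nat.le_succ n) le_rfl
    rw [EulerBound.succ_iff] at hf ⊢
    constructor
    · calc ‖invWeight s * f s‖ ≤ ‖invWeight s‖ * B := by
            simpa using mul_le_mul_of_nonneg_left hf.1 (norm_nonneg (invWeight s))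
        _ ≤ _ := le_mul_of_one_le_left hB (by nlinarith)
    · -- `Z (v f) = v (Z f + v f - f)` for `Z` the operator and `v` the weight
      have e : dbarEuler (fun t => invWeight t * f t) = fun t =>
          invWeight t * ((dbarEuler f t + invWeight t * f t) + (-1) * f t) := by
        funext t
        rw [dbarEuler_mul (contDiff_invWeight.differentiable (by simp) t)
          (hfc.differentiable (by simp) t), dbarEuler_invWeight]
        ring
      have hc1 := contDiff_dbarEuler hfc
      have hc2 : ContDiff ℝ ∞ fun t => invWeight t * f t := contDiff_invWeight.mul hfc
      have hc3 : ContDiff ℝ ∞ fun t => (-1) * f t := contDiff_const.mul hfc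
      have hb := ih ((hc1.add hc2).add hc3)
        ((hf.2.add hc1 hc2 (ih hfc hfn)).add (hc1.add hc2) hc3 (hfn.const_mul (-1) hfc))
      rw [e]
      refine hb.mono le_rfl ?_
      have hv : ‖invWeight s‖ * B ≤ B :=
        mul_le_of_le_one_left hB0 (norm_invWeight_le_one s)
      have : B + C * (‖invWeight s‖ * B) + ‖(-1 : ℂ)‖ * B ≤ (2 + C) * B := by
        rw [norm_neg, norm_one]
        nlinarith
      calc _ ≤ C * (‖invWeight s‖ * ((2 + C) * B)) := by gcongr
        _ = _ := by ring

/-- Each application of the transposed operator gains a factor `(1 + |s|²)⁻¹`. -/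
theorem exists_eulerBound_transOp (d n : ℕ) :
    ∃ C : ℝ, 0 ≤ C ∧ ∀ {f : CSpace d → ℂ} {s : CSpace d} {B : ℝ}, ContDiff ℝ ∞ f →
      EulerBound (n + 1) f s B → EulerBound n (transOp f) s (C * (‖invWeight s‖ * B)) := by
  obtain ⟨C, hC, hv⟩ := exists_eulerBound_invWeight_mul n
  refine ⟨C * (1 + d + C), by positivity, fun {f s B} hfc hf => ?_⟩
  have hB0 : 0 ≤ B := (norm_nonneg _).trans (hf 0 (by omega))
  have hfn := hf.mono (Nat.le_succ n) le_rfl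
  rw [EulerBound.succ_iff] at hf
  have e : transOp f = fun t =>
      invWeight t * ((dbarEuler f t + d * f t) + invWeight t * f t) := by
    rw [transOp_eq hfc]
    funext t
    ring
  have hc1 := contDiff_dbarEuler hfc
  have hc2 : ContDiff ℝ ∞ fun t => invWeight t * f t := contDiff_invWeight.mul hfc
  have hc3 : ContDiff ℝ ∞ fun t => (d : ℂ) * f t := contDiff_const.mul hfc
  have hb := hv ((hc1.add hc3).add hc2)
    ((hf.2.add hc1 hc3 (hfn.const_mul d hfc)).add (hc1.add hc3) hc2 (hv hfc hfn))
  rw [e]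
  refine hb.mono le_rfl ?_
  have hvB : ‖invWeight s‖ * B ≤ B := mul_le_of_le_one_left hB0 (norm_invWeight_le_one s)
  have : B + ‖(d : ℂ)‖ * B + C * (‖invWeight s‖ * B) ≤ (1 + d + C) * B := by
    rw [Complex.norm_natCast]
    nlinarith
  calc _ ≤ C * (‖invWeight s‖ * ((1 + d + C) * B)) := by gcongr
    _ = _ := by ring

theorem exists_norm_iterate_transOp_le (d n : ℕ) :
    ∃ C : ℝ, 0 ≤ C ∧ ∀ {f : CSpace d → ℂ} {s : CSpace d} {B : ℝ}, ContDiff ℝ ∞ f →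
      EulerBound n f s B → ‖transOp^[n] f s‖ ≤ C * (‖invWeight s‖ ^ n * B) := by
  induction n with
  | zero => exact ⟨1, zero_le_one, fun {f s B} _ hf => by simpa using hf 0 le_rfl⟩
  | succ n ih =>
    obtain ⟨C, hC, ih⟩ := ih
    obtain ⟨C', hC', hT⟩ := exists_eulerBound_transOp d n
    refine ⟨C * C', by positivity, fun {f s B} hfc hf => ?_⟩
    rw [Function.iterate_succ_apply]
    refine (ih (contDiff_transOp hfc) (hT hfc hf)).trans_eq ?_
    ring

/-! ### From derivative bounds to bounds for the Euler operator -/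

/-- At the point `s`, `‖f⁽ʲ⁾(s)‖ ≤ B (1 + |s|)⁻ʲ` for `j ≤ n`. -/
def DerivBound {d : ℕ} (n : ℕ) (f : CSpace d → ℂ) (s : CSpace d) (B : ℝ) : Prop :=
  ∀ j ≤ n, (1 + ‖s‖) ^ j * ‖iteratedFDeriv ℝ j f s‖ ≤ B

theorem norm_iteratedFDeriv_clm_le {E F : Type*} [NormedAddCommGroup E] [NormedSpace ℝ E]
    [NormedAddCommGroup F] [NormedSpace ℝ F] (L : E →L[ℝ] F) (hL : ‖L‖ ≤ 1) (s : E) (m : ℕ) :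
    (1 + ‖s‖) ^ m * ‖iteratedFDeriv ℝ m L s‖ ≤ 1 + ‖s‖ := by
  have hs := norm_nonneg s
  match m with
  | 0 =>
    rw [pow_zero, one_mul, norm_iteratedFDeriv_zero]
    nlinarith [L.le_opNorm s]
  | 1 =>
    rw [← norm_iteratedFDeriv_fderiv, norm_iteratedFDeriv_zero, L.fderiv]
    nlinarith
  | m + 2 =>
    rw [← norm_iteratedFDeriv_fderiv]
    have : fderiv ℝ L = fun _ => L := funext fun x => L.fderiv
    rw [this, iteratedFDeriv_const_of_ne (by omega)]
    simp
    positivity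

theorem norm_iteratedFDeriv_fderiv_apply_le {d n : ℕ} {f : CSpace d → ℂ} {s : CSpace d} {B : ℝ}
    (hfc : ContDiff ℝ ∞ f) (hf : DerivBound (n + 1) f s B) (L : CSpace d →L[ℝ] CSpace d)
    (hL : ‖L‖ ≤ 1) :
    (1 + ‖s‖) ^ n * ‖iteratedFDeriv ℝ n (fun t => fderiv ℝ f t (L t)) s‖ ≤ 2 ^ n * B := by
  have hw : 0 < 1 + ‖s‖ := by positivity
  have h1 : ContDiff ℝ ∞ (fderiv ℝ f) := hfc.fderiv_right (by simp)
  have h := norm_iteratedFDeriv_clm_apply h1 L.contDiff s (n := n) (by exact_mod_cast le_top)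
  refine le_of_mul_le_mul_left ?_ hw
  calc (1 + ‖s‖) * ((1 + ‖s‖) ^ n * ‖iteratedFDeriv ℝ n (fun t => fderiv ℝ f t (L t)) s‖)
      ≤ (1 + ‖s‖) * ((1 + ‖s‖) ^ n * ∑ i ∈ Finset.range (n + 1), (n.choose i : ℝ)
          * ‖iteratedFDeriv ℝ i (fderiv ℝ f) s‖ * ‖iteratedFDeriv ℝ (n - i) L s‖) := by gcongr
    _ = ∑ i ∈ Finset.range (n + 1), (n.choose i : ℝ) *
          (((1 + ‖s‖) ^ (i + 1) * ‖iteratedFDeriv ℝ (i + 1) f s‖) *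
            ((1 + ‖s‖) ^ (n - i) * ‖iteratedFDeriv ℝ (n - i) L s‖)) := by
        rw [Finset.mul_sum, Finset.mul_sum]
        refine Finset.sum_congr rfl fun i hi => ?_
        have hi' : i ≤ n := by simpa [Nat.lt_succ_iff] using hi
        have e : (1 + ‖s‖) ^ n = (1 + ‖s‖) ^ i * (1 + ‖s‖) ^ (n - i) := by
          rw [← pow_add]; congr 1; omega
        rw [norm_iteratedFDeriv_fderiv, e]
        ring
    _ ≤ ∑ i ∈ Finset.range (n + 1), (n.choose i : ℝ) * (B * (1 + ‖s‖)) := by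
        refine Finset.sum_le_sum fun i hi => ?_
        have hi' : i ≤ n := by simpa [Nat.lt_succ_iff] using hi
        have hB : 0 ≤ B := le_trans (by positivity) (hf 0 (by omega))
        gcongr
        · exact hf (i + 1) (by omega)
        · exact norm_iteratedFDeriv_clm_le L hL s _
    _ = (1 + ‖s‖) * (2 ^ n * B) := by
        rw [← Finset.sum_mul]
        have : (∑ i ∈ Finset.range (n + 1), (n.choose i : ℝ)) = 2 ^ n := by
          exact_mod_cast Nat.sum_range_choose n
        rw [this]
        ring

theorem DerivBound.dbarEuler {d n : ℕ} {f : CSpace d → ℂ} {s : CSpace d} {B : ℝ}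
    (hfc : ContDiff ℝ ∞ f) (hf : DerivBound (n + 1) f s B) :
    DerivBound n (dbarEuler f) s (2 ^ n * B) := by
  intro j hj
  have hfj : DerivBound (j + 1) f s B := fun i hi => hf i (by omega)
  have hB : 0 ≤ B := le_trans (by positivity) (hf 0 (by omega))
  have h1 : ContDiff ℝ ∞ (fderiv ℝ f) := hfc.fderiv_right (by simp)
  have c1 : ContDiff ℝ ∞ fun t => fderiv ℝ f t (ContinuousLinearMap.id ℝ (CSpace d) t) :=
    h1.clm_apply contDiff_id
  have c2 : ContDiff ℝ ∞ fun t => fderiv ℝ f t (mulI d t) := h1.clm_apply (mulI d).contDiff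
  have b1 := norm_iteratedFDeriv_fderiv_apply_le hfc hfj (ContinuousLinearMap.id ℝ _)
    ContinuousLinearMap.norm_id_le
  have b2 := norm_iteratedFDeriv_fderiv_apply_le hfc hfj (mulI d) (norm_mulI_le d)
  set F₁ : CSpace d → ℂ := fun t => fderiv ℝ f t (ContinuousLinearMap.id ℝ (CSpace d) t)
  set F₂ : CSpace d → ℂ := fun t => fderiv ℝ f t (mulI d t)
  have e : Bargmann.dbarEuler f = (1 / 2 : ℂ) • (F₁ + Complex.I • F₂) := rfl
  have hj' : (j : ℕ∞ω) ≤ ∞ := by exact_mod_cast le_top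
  have d1 := (c1.of_le hj').contDiffAt (x := s)
  have d2 := (c2.of_le hj').contDiffAt (x := s)
  have d3 : ContDiffAt ℝ j (Complex.I • F₂) s := ContDiffAt.const_smul Complex.I d2
  have d4 : ContDiffAt ℝ j (F₁ + Complex.I • F₂) s := d1.add d3
  rw [e, iteratedFDeriv_const_smul_apply d4, iteratedFDeriv_add_apply d1 d3,
    iteratedFDeriv_const_smul_apply d2, norm_smul]
  have hle : ‖iteratedFDeriv ℝ j F₁ s + Complex.I • iteratedFDeriv ℝ j F₂ s‖
      ≤ ‖iteratedFDeriv ℝ j F₁ s‖ + ‖iteratedFDeriv ℝ j F₂ s‖ := by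
    refine (norm_add_le _ _).trans ?_
    rw [norm_smul, Complex.norm_I, one_mul]
  have hpow : (2 : ℝ) ^ j * B ≤ 2 ^ n * B := by gcongr; norm_num
  have hn : ‖(1 / 2 : ℂ)‖ = 1 / 2 := by norm_num
  have hw : 0 ≤ (1 + ‖s‖) ^ j := by positivity
  rw [hn]
  nlinarith [mul_le_mul_of_nonneg_left hle hw]

theorem DerivBound.eulerBound {d n : ℕ} {f : CSpace d → ℂ} {s : CSpace d} {B : ℝ}
    (hfc : ContDiff ℝ ∞ f) (hf : DerivBound n f s B) :
    EulerBound n f s (2 ^ (n * n) * B) := by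
  induction n generalizing f B with
  | zero =>
    intro k hk
    obtain rfl : k = 0 := by omega
    simpa using hf 0 le_rfl
  | succ n ih =>
    have hB : 0 ≤ B := le_trans (by positivity) (hf 0 (by omega))
    rw [EulerBound.succ_iff]
    constructor
    · have h0 : ‖f s‖ ≤ B := by simpa using hf 0 (by omega)
      exact h0.trans (le_mul_of_one_le_left hB (one_le_pow₀ (by norm_num)))
    · refine (ih (contDiff_dbarEuler hfc) (DerivBound.dbarEuler hfc hf)).mono le_rfl ?_
      rw [← mul_assoc, ← pow_add]
      gcongr
      · norm_num
      · nlinarith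

/-- Bounds on derivatives up to order `n` give decay `(1 + |s|²)⁻ⁿ` of the `n`-th iterate. -/
theorem exists_norm_iterate_transOp_le_of_derivBound (d n : ℕ) :
    ∃ C : ℝ, 0 ≤ C ∧ ∀ {f : CSpace d → ℂ} {s : CSpace d} {B : ℝ}, ContDiff ℝ ∞ f →
      DerivBound n f s B → ‖transOp^[n] f s‖ ≤ C * (((1 + ‖s‖ ^ 2)⁻¹) ^ n * B) := by
  obtain ⟨C, hC, h⟩ := exists_norm_iterate_transOp_le d n
  refine ⟨C * 2 ^ (n * n), by positivity, fun {f s B} hfc hf => ?_⟩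
  refine (h hfc (hf.eulerBound hfc)).trans_eq ?_
  rw [norm_invWeight]
  ring

/-! ### Integration by parts -/

/-- The real-linear functional `s ↦ s̄ⱼ`. -/
def conjCoord {d : ℕ} (j : Fin d) : CSpace d →L[ℝ] ℂ :=
  (Complex.conjCLE : ℂ →L[ℝ] ℂ).comp
    ((EuclideanSpace.proj (𝕜 := ℂ) j : CSpace d →L[ℂ] ℂ).restrictScalars ℝ)

theorem conjCoord_apply {d : ℕ} (j : Fin d) (s : CSpace d) :
    conjCoord j s = (starRingEnd ℂ) (s j) := rfl

/-- The coordinate form of the antiholomorphic Euler operator, for a real-linear functional in place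
of the derivative. -/
theorem linear_add_I_mul_eq_sum {d : ℕ} (ℓ : CSpace d →L[ℝ] ℂ) (s : CSpace d) :
    ℓ s + Complex.I * ℓ (Complex.I • s) = ∑ j, conjCoord j s *
      (ℓ (EuclideanSpace.single j 1) + Complex.I * ℓ (EuclideanSpace.single j Complex.I)) := by
  have h1 : ∀ t : CSpace d, t = ∑ j, ((t j).re • EuclideanSpace.single j (1 : ℂ)
      + (t j).im • EuclideanSpace.single j Complex.I) := by
    intro t
    ext k
    simp [Finset.sum_apply, Pi.single_apply, Finset.sum_add_distrib]
  have h2 : ∀ t : CSpace d, ℓ t = ∑ j, ((t j).re * ℓ (EuclideanSpace.single j (1 : ℂ))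
      + (t j).im * ℓ (EuclideanSpace.single j Complex.I)) := by
    intro t
    conv_lhs => rw [h1 t]
    simp [map_sum]
  rw [h2 s, h2 (Complex.I • s), Finset.mul_sum, ← Finset.sum_add_distrib]
  refine Finset.sum_congr rfl fun j _ => ?_
  have hc : conjCoord j s = (s j).re - (s j).im * Complex.I := by
    rw [conjCoord_apply, Complex.ext_iff]; simp
  rw [hc]
  simp
  ring_nf
  simp

/-- Integration by parts for the antiholomorphic Euler operator. -/
theorem integral_mul_dbarEuler {d : ℕ} {f G : CSpace d → ℂ} (hf : ContDiff ℝ 1 f)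
    (hfc : HasCompactSupport f) (hG : Differentiable ℝ G)
    (hG' : ∀ v, LocallyIntegrable fun s => fderiv ℝ G s v) :
    ∫ s, f s * dbarEuler G s = -∫ s, (dbarEuler f s + d * f s) * G s := by
  have hGc : Continuous G := hG.continuous
  have hf' : ∀ v, Continuous fun s => fderiv ℝ f s v := fun v =>
    (hf.continuous_fderiv one_ne_zero).clm_apply continuous_const
  have hf'c : ∀ v, HasCompactSupport fun s => fderiv ℝ f s v := fun v =>
    hfc.fderiv_apply (𝕜 := ℝ) v
  -- the integrations by parts in a real direction `v`, against `s̄ⱼ f`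
  have key : ∀ (j : Fin d) (v : CSpace d),
      Integrable (fun s => conjCoord j s * f s * fderiv ℝ G s v) ∧
      Integrable (fun s => (conjCoord j v * f s + conjCoord j s * fderiv ℝ f s v) * G s) ∧
      ∫ s, conjCoord j s * f s * fderiv ℝ G s v
        = -∫ s, (conjCoord j v * f s + conjCoord j s * fderiv ℝ f s v) * G s := by
    intro j v
    have hA : ContDiff ℝ 1 fun s => conjCoord j s * f s := (conjCoord j).contDiff.mul hf
    have hAc : HasCompactSupport fun s => conjCoord j s * f s := hfc.mul_left
    have hA' : ∀ s, fderiv ℝ (fun s => conjCoord j s * f s) s v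
        = conjCoord j v * f s + conjCoord j s * fderiv ℝ f s v := by
      intro s
      rw [fderiv_fun_mul (conjCoord j).differentiableAt (hf.differentiable one_ne_zero s)]
      simp only [_root_.add_apply, _root_.smul_apply, smul_eq_mul, (conjCoord j).fderiv]
      ring
    have i1 : Integrable fun s => conjCoord j s * f s * fderiv ℝ G s v :=
      (hG' v).integrable_smul_left_of_hasCompactSupport hA.continuous hAc
    have i2 : Integrable fun s => (conjCoord j v * f s + conjCoord j s * fderiv ℝ f s v) * G s := by
      refine Continuous.integrable_of_hasCompactSupport ?_ ?_
      · exact ((continuous_const.mul hf.continuous).add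
          ((conjCoord j).continuous.mul (hf' v))).mul hGc
      · exact (hfc.mul_left.add (hf'c v).mul_left).mul_right
    refine ⟨i1, i2, ?_⟩
    have h := integral_mul_fderiv_eq_neg_fderiv_mul_of_integrable (μ := volume)
      (f := fun s => conjCoord j s * f s) (g := G) (v := v) (by simpa only [hA'] using i2) i1
      ((hA.continuous.mul hGc).integrable_of_hasCompactSupport hAc.mul_right)
      (fun s _ => hA.differentiable one_ne_zero s) (fun s _ => hG s)
    simpa only [hA'] using h
  have e1 : ∀ s, f s * dbarEuler G s = ∑ j, (1 / 2 : ℂ) *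
      (conjCoord j s * f s * fderiv ℝ G s (EuclideanSpace.single j 1) + Complex.I *
        (conjCoord j s * f s * fderiv ℝ G s (EuclideanSpace.single j Complex.I))) := by
    intro s
    rw [dbarEuler, linear_add_I_mul_eq_sum, Finset.mul_sum, Finset.mul_sum]
    exact Finset.sum_congr rfl fun j _ => by ring
  have e2 : ∀ s, (dbarEuler f s + d * f s) * G s = ∑ j, (1 / 2 : ℂ) *
      ((conjCoord j (EuclideanSpace.single j 1) * f s
          + conjCoord j s * fderiv ℝ f s (EuclideanSpace.single j 1)) * G s + Complex.I *
        ((conjCoord j (EuclideanSpace.single j Complex.I) * f s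
          + conjCoord j s * fderiv ℝ f s (EuclideanSpace.single j Complex.I)) * G s)) := by
    intro s
    have hd : (d : ℂ) * f s = ∑ _j : Fin d, f s := by simp
    rw [dbarEuler, linear_add_I_mul_eq_sum, hd, Finset.mul_sum, ← Finset.sum_add_distrib,
      Finset.sum_mul]
    refine Finset.sum_congr rfl fun j _ => ?_
    simp only [conjCoord_apply, PiLp.single_apply, if_true, map_one, Complex.conj_I]
    ring_nf
    simp only [Complex.I_sq]
    ring
  -- linearity of the integral, for the combinations that occur
  have comb : ∀ F₁ F₂ : Fin d → CSpace d → ℂ, (∀ j, Integrable (F₁ j)) → (∀ j, Integrable (F₂ j)) →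
      ∫ s, ∑ j, (1 / 2 : ℂ) * (F₁ j s + Complex.I * F₂ j s)
        = ∑ j, (1 / 2 : ℂ) * ((∫ s, F₁ j s) + Complex.I * ∫ s, F₂ j s) := by
    intro F₁ F₂ h₁ h₂
    have h₃ : ∀ j, Integrable fun s => (1 / 2 : ℂ) * (F₁ j s + Complex.I * F₂ j s) := fun j =>
      ((h₁ j).add ((h₂ j).const_mul Complex.I)).const_mul (1 / 2 : ℂ)
    rw [integral_finsetSum _ fun j _ => h₃ j]
    refine Finset.sum_congr rfl fun j _ => ?_
    rw [integral_const_mul, integral_add (h₁ j) ((h₂ j).const_mul Complex.I), integral_const_mul]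
  simp only [e1, e2]
  rw [comb _ _ (fun j => (key j _).1) fun j => (key j _).1,
    comb _ _ (fun j => (key j _).2.1) fun j => (key j _).2.1, ← Finset.sum_neg_distrib]
  refine Finset.sum_congr rfl fun j _ => ?_
  rw [(key j _).2.2, (key j _).2.2]
  ring

theorem integral_transOp_mul {d : ℕ} {f G : CSpace d → ℂ} (hf : ContDiff ℝ ∞ f)
    (hfc : HasCompactSupport f) (hG : Differentiable ℝ G)
    (hG' : ∀ v, LocallyIntegrable fun s => fderiv ℝ G s v)
    (hGZ : ∀ s, dbarEuler G s = -(‖s‖ ^ 2 : ℝ) * G s) :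
    ∫ s, transOp f s * G s = ∫ s, f s * G s := by
  have hg : ContDiff ℝ ∞ fun t => invWeight t * f t := contDiff_invWeight.mul hf
  have hgc : HasCompactSupport fun t => invWeight t * f t := hfc.mul_left
  have hgc' : HasCompactSupport (dbarEuler fun t => invWeight t * f t) :=
    hgc.of_isClosed_subset (isClosed_tsupport _) (tsupport_dbarEuler_subset _)
  have h := integral_mul_dbarEuler (hg.of_le (by exact_mod_cast le_top)) hgc hG hG'
  have hGc : Continuous G := hG.continuous
  have i1 : Integrable fun s => (dbarEuler (fun t => invWeight t * f t) s
      + d * (invWeight s * f s)) * G s :=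
    (((contDiff_dbarEuler hg).continuous.add (continuous_const.mul hg.continuous)).mul
      hGc).integrable_of_hasCompactSupport (hgc'.add hgc.mul_left).mul_right
  have i2 : Integrable fun s => invWeight s * f s * G s :=
    (hg.continuous.mul hGc).integrable_of_hasCompactSupport hgc.mul_right
  have i3 : Integrable fun s => f s * G s :=
    (hf.continuous.mul hGc).integrable_of_hasCompactSupport hfc.mul_right
  have e1 : ∀ s, transOp f s * G s = (dbarEuler (fun t => invWeight t * f t) s
      + d * (invWeight s * f s)) * G s + invWeight s * f s * G s := by
    intro s
    rw [transOp]
    ring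
  -- `|s|² / (1 + |s|²) = 1 - 1 / (1 + |s|²)`
  have e2 : ∀ s, invWeight s * f s * dbarEuler G s = invWeight s * f s * G s - f s * G s := by
    intro s
    have hw : (1 + (‖s‖ : ℂ) ^ 2) ≠ 0 := by exact_mod_cast (one_add_norm_sq_pos s).ne'
    rw [hGZ, invWeight]
    push_cast
    field_simp
    ring
  simp only [e2] at h
  rw [integral_sub i2 i3] at h
  simp only [e1]
  rw [integral_add i1 i2]
  linear_combination h

theorem integral_iterate_transOp_mul {d : ℕ} {f G : CSpace d → ℂ} (hf : ContDiff ℝ ∞ f)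
    (hfc : HasCompactSupport f) (hG : Differentiable ℝ G)
    (hG' : ∀ v, LocallyIntegrable fun s => fderiv ℝ G s v)
    (hGZ : ∀ s, dbarEuler G s = -(‖s‖ ^ 2 : ℝ) * G s) (n : ℕ) :
    ∫ s, transOp^[n] f s * G s = ∫ s, f s * G s := by
  induction n with
  | zero => rfl
  | succ n ih =>
    rw [Function.iterate_succ_apply', integral_transOp_mul (contDiff_iterate_transOp hf n)
      (hasCompactSupport_iterate_transOp hfc n) hG hG' hGZ, ih]

/-! ### The oscillating factor -/

/-- Directional derivatives of an entire function of several variables are continuous, by Cauchy's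
formula in the direction. -/
theorem continuous_fderiv_apply_of_differentiable {d : ℕ} {g : CSpace d → ℂ}
    (hg : Differentiable ℂ g) (v : CSpace d) : Continuous fun z => fderiv ℂ g z v := by
  have e : ∀ z, fderiv ℂ g z v
      = (2 * Real.pi * Complex.I : ℂ)⁻¹ • ∮ ζ in C(0, 1), ((ζ - 0) ^ 2)⁻¹ • g (z + ζ • v) := by
    intro z
    have hline : Differentiable ℂ fun ζ : ℂ => g (z + ζ • v) :=
      hg.comp ((differentiable_const z).add (differentiable_id.smul_const v))
    have h := Complex.two_pi_I_inv_smul_circleIntegral_sub_sq_inv_smul_of_differentiable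
      (U := univ) (c := (0 : ℂ)) (R := 1) (w₀ := 0) isOpen_univ (subset_univ _)
      hline.differentiableOn (by simp)
    rw [h]
    have h1 : HasDerivAt (fun ζ : ℂ => z + ζ • v) v 0 := by
      simpa using! ((hasDerivAt_id (0 : ℂ)).smul_const v).const_add z
    have h2 : HasFDerivAt g (fderiv ℂ g z) (z + (0 : ℂ) • v) := by
      simpa using (hg z).hasFDerivAt
    exact (h2.comp_hasDerivAt (0 : ℂ) h1).deriv.symm
  simp only [e, circleIntegral]
  have hm : Continuous fun q : CSpace d × ℝ => circleMap (0 : ℂ) 1 q.2 :=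
    (continuous_circleMap 0 1).comp continuous_snd
  have hne : ∀ q : CSpace d × ℝ, (circleMap (0 : ℂ) 1 q.2 - 0) ^ 2 ≠ 0 := fun q => by
    simp [circleMap]
  have hc : Continuous fun q : CSpace d × ℝ => deriv (circleMap (0 : ℂ) 1) q.2 •
      ((circleMap (0 : ℂ) 1 q.2 - 0) ^ 2)⁻¹ • g (q.1 + circleMap (0 : ℂ) 1 q.2 • v) := by
    simp only [deriv_circleMap]
    exact (hm.mul continuous_const).smul ((((hm.sub continuous_const).pow 2).inv₀ hne).smul
      (hg.continuous.comp (continuous_fst.add (hm.smul continuous_const))))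
  have hI := intervalIntegral.continuous_parametric_intervalIntegral_of_continuous' (μ := volume)
    (f := fun (z : CSpace d) (θ : ℝ) => deriv (circleMap (0 : ℂ) 1) θ •
      ((circleMap (0 : ℂ) 1 θ - 0) ^ 2)⁻¹ • g (z + circleMap (0 : ℂ) 1 θ • v)) hc 0 (2 * Real.pi)
  exact hI.const_smul (2 * Real.pi * Complex.I : ℂ)⁻¹

/-- The exponent of the Weyl kernel after the substitution `y = x + 2 t s` with `t = h^{1/2}`. -/
def weylExponent {d : ℕ} (t : ℝ) (x s : CSpace d) : ℂ :=
  2 * Complex.I * ∑ j, s j * ((t⁻¹ * (x j).im + (s j).im : ℝ) : ℂ)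

/-- The oscillating factor of the Weyl kernel times `u`, after the substitution `y = x + 2 t s` with
`t = h^{1/2}`. -/
def weylFactor {d : ℕ} (t : ℝ) (x : CSpace d) (u : CSpace d → ℂ) (s : CSpace d) : ℂ :=
  Complex.exp (weylExponent t x s) * u (x + (2 * t) • s)

/-- The real-linear map `s ↦ Im sⱼ`, with complex values. -/
def imCoord {d : ℕ} (j : Fin d) : CSpace d →L[ℝ] ℂ :=
  (Complex.ofRealCLM.comp Complex.imCLM).comp
    ((EuclideanSpace.proj (𝕜 := ℂ) j : CSpace d →L[ℂ] ℂ).restrictScalars ℝ)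

theorem imCoord_apply {d : ℕ} (j : Fin d) (s : CSpace d) : imCoord j s = ((s j).im : ℂ) := rfl

/-- The real-linear map `s ↦ sⱼ`. -/
def realCoord {d : ℕ} (j : Fin d) : CSpace d →L[ℝ] ℂ :=
  (EuclideanSpace.proj (𝕜 := ℂ) j : CSpace d →L[ℂ] ℂ).restrictScalars ℝ

theorem realCoord_apply {d : ℕ} (j : Fin d) (s : CSpace d) : realCoord j s = s j := rfl

theorem weylExponent_eq {d : ℕ} (t : ℝ) (x : CSpace d) : weylExponent t x = fun s =>
    2 * Complex.I * ∑ j, realCoord j s * ((t⁻¹ * (x j).im : ℝ) + imCoord j s) := by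
  funext s
  simp [weylExponent, realCoord_apply, imCoord_apply]

theorem contDiff_weylExponent {d : ℕ} (t : ℝ) (x : CSpace d) :
    ContDiff ℝ ∞ (weylExponent t x) := by
  rw [weylExponent_eq]
  exact contDiff_const.mul (ContDiff.sum fun j _ =>
    (realCoord j).contDiff.mul (contDiff_const.add (imCoord j).contDiff))

theorem fderiv_weylExponent {d : ℕ} (t : ℝ) (x s v : CSpace d) :
    fderiv ℝ (weylExponent t x) s v = 2 * Complex.I *
      ∑ j, (v j * ((t⁻¹ * (x j).im : ℝ) + (s j).im : ℂ) + s j * (v j).im) := by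
  have h1 := fun j : Fin d => ((realCoord j).hasFDerivAt (x := s)).mul
    (((imCoord j).hasFDerivAt (x := s)).const_add ((t⁻¹ * (x j).im : ℝ) : ℂ))
  have h2 := (HasFDerivAt.fun_sum (u := Finset.univ) fun j _ => h1 j).const_mul (2 * Complex.I)
  have h := h2.fderiv
  simp only [Pi.mul_apply] at h
  rw [weylExponent_eq, h]
  simp only [_root_.smul_apply, sum_apply, _root_.add_apply, smul_eq_mul, imCoord_apply,
    realCoord_apply]
  congr 1
  exact Finset.sum_congr rfl fun j _ => by ring

/-- The phase gains `-|s|²` under the antiholomorphic Euler operator. -/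
theorem dbarEuler_weylExponent {d : ℕ} (t : ℝ) (x s : CSpace d) :
    dbarEuler (weylExponent t x) s = -(‖s‖ ^ 2 : ℝ) := by
  have hn : ((‖s‖ ^ 2 : ℝ) : ℂ) = ∑ j, (((s j).re ^ 2 + (s j).im ^ 2 : ℝ) : ℂ) := by
    rw [EuclideanSpace.norm_sq_eq]
    push_cast
    refine Finset.sum_congr rfl fun j _ => ?_
    have := Complex.sq_norm (s j)
    rw [Complex.normSq_apply] at this
    exact_mod_cast this.trans (by ring)
  rw [dbarEuler, fderiv_weylExponent, fderiv_weylExponent, hn, ← Finset.sum_neg_distrib]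
  simp only [Finset.mul_sum]
  rw [← Finset.sum_add_distrib, Finset.mul_sum]
  refine Finset.sum_congr rfl fun j _ => ?_
  apply Complex.ext <;> simp [-Complex.ofReal_pow] <;> ring

theorem differentiable_translate_dilate {d : ℕ} {u : CSpace d → ℂ} (hu : Differentiable ℂ u)
    (t : ℝ) (x : CSpace d) : Differentiable ℂ fun s => u (x + (2 * t) • s) := by
  have e : ∀ s : CSpace d, (2 * t) • s = ((2 * t : ℝ) : ℂ) • s := fun s => by ext j; simp
  simp only [e]
  exact hu.comp (by fun_prop)

theorem fderiv_real_eq_restrictScalars {d : ℕ} {g : CSpace d → ℂ} (hg : Differentiable ℂ g)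
    (s : CSpace d) : fderiv ℝ g s = (fderiv ℂ g s).restrictScalars ℝ :=
  ((hg s).hasFDerivAt.restrictScalars ℝ).fderiv

theorem differentiable_weylFactor {d : ℕ} {u : CSpace d → ℂ} (hu : Differentiable ℂ u)
    (t : ℝ) (x : CSpace d) : Differentiable ℝ (weylFactor t x u) := by
  have h1 : Differentiable ℝ (weylExponent t x) :=
    (contDiff_weylExponent t x).differentiable (by simp)
  have h2 : Differentiable ℝ fun s => u (x + (2 * t) • s) := fun s =>
    ((differentiable_translate_dilate hu t x s).hasFDerivAt.restrictScalars ℝ).differentiableAt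
  exact h1.cexp.mul h2

theorem locallyIntegrable_fderiv_weylFactor {d : ℕ} {u : CSpace d → ℂ} (hu : Differentiable ℂ u)
    (t : ℝ) (x v : CSpace d) :
    LocallyIntegrable fun s => fderiv ℝ (weylFactor t x u) s v := by
  have h1 : Differentiable ℝ (weylExponent t x) :=
    (contDiff_weylExponent t x).differentiable (by simp)
  have hu' := differentiable_translate_dilate hu t x
  have h2 : Differentiable ℝ fun s => u (x + (2 * t) • s) := fun s =>
    ((hu' s).hasFDerivAt.restrictScalars ℝ).differentiableAt
  have e : (fun s => fderiv ℝ (weylFactor t x u) s v) = fun s =>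
      Complex.exp (weylExponent t x s) * fderiv ℂ (fun s => u (x + (2 * t) • s)) s v
      + u (x + (2 * t) • s) * (Complex.exp (weylExponent t x s)
        * fderiv ℝ (weylExponent t x) s v) := by
    funext s
    have h3 := ((h1 s).hasFDerivAt.cexp).mul (h2 s).hasFDerivAt
    have h4 : fderiv ℝ (weylFactor t x u) s = _ := h3.fderiv
    rw [h4, fderiv_real_eq_restrictScalars hu']
    simp
  rw [e]
  refine Continuous.locallyIntegrable ?_
  have c1 : Continuous fun s => Complex.exp (weylExponent t x s) := h1.cexp.continuous
  have c2 : Continuous fun s => fderiv ℝ (weylExponent t x) s v :=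
    ((contDiff_weylExponent t x).continuous_fderiv (by simp)).clm_apply continuous_const
  exact (c1.mul (continuous_fderiv_apply_of_differentiable hu' v)).add
    (hu'.continuous.mul (c1.mul c2))

theorem dbarEuler_weylFactor {d : ℕ} {u : CSpace d → ℂ} (hu : Differentiable ℂ u)
    (t : ℝ) (x s : CSpace d) :
    dbarEuler (weylFactor t x u) s = -(‖s‖ ^ 2 : ℝ) * weylFactor t x u s := by
  have h1 : Differentiable ℝ (weylExponent t x) :=
    (contDiff_weylExponent t x).differentiable (by simp)
  have hu' := differentiable_translate_dilate hu t x
  have h2 : Differentiable ℝ fun s => u (x + (2 * t) • s) := fun s =>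
    ((hu' s).hasFDerivAt.restrictScalars ℝ).differentiableAt
  have h3 : dbarEuler (fun s => Complex.exp (weylExponent t x s)) s
      = Complex.exp (weylExponent t x s) * dbarEuler (weylExponent t x) s := by
    simp only [dbarEuler, (h1 s).hasFDerivAt.cexp.fderiv, _root_.smul_apply, smul_eq_mul]
    ring
  have h4 := dbarEuler_mul (h1.cexp s) (h2 s)
  rw [h3, dbarEuler_of_differentiableAt (hu' s), dbarEuler_weylExponent] at h4
  rw [show weylFactor t x u = fun s => Complex.exp (weylExponent t x s) * u (x + (2 * t) • s)
    from rfl, h4]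
  ring

theorem Phi0_eq_sum {d : ℕ} (x : CSpace d) : Phi0 x = (∑ j, (x j).im ^ 2) / 2 := by
  simp [Phi0, EuclideanSpace.norm_sq_eq, imVec]

/-- The modulus of the oscillating factor: the exponential weights at `x` and at `x + 2 t s`. -/
theorem norm_weylFactor {d : ℕ} (u : CSpace d → ℂ) {t : ℝ} (ht : 0 < t) (x s : CSpace d) :
    ‖weylFactor t x u s‖ = Real.exp (Phi0 x / t ^ 2) *
      (Real.exp (-(Phi0 (x + (2 * t) • s) / t ^ 2)) * ‖u (x + (2 * t) • s)‖) := by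
  rw [weylFactor, norm_mul, Complex.norm_exp, ← mul_assoc, ← Real.exp_add]
  congr 2
  rw [Phi0_eq_sum, Phi0_eq_sum, weylExponent, ← neg_div, Finset.mul_sum, Complex.re_sum]
  simp only [Finset.sum_div, ← Finset.sum_neg_distrib]
  rw [← Finset.sum_add_distrib]
  refine Finset.sum_congr rfl fun j _ => ?_
  simp
  field_simp
  ring

/-! ### Symbols vanishing to third order -/

theorem norm_le_of_norm_fderiv_le_pow {V F : Type*} [NormedAddCommGroup V] [NormedSpace ℝ V]
    [NormedAddCommGroup F] [NormedSpace ℝ F] {g : V → F} (hg : Differentiable ℝ g) (h0 : g 0 = 0)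
    {C : ℝ} {n : ℕ} (hC : 0 ≤ C) (hb : ∀ X, ‖fderiv ℝ g X‖ ≤ C * ‖X‖ ^ n) (X : V) :
    ‖g X‖ ≤ C * ‖X‖ ^ (n + 1) := by
  have h := (convex_closedBall (0 : V) ‖X‖).norm_image_sub_le_of_norm_fderiv_le (𝕜 := ℝ) (f := g)
    (C := C * ‖X‖ ^ n) (x := 0) (y := X) (fun z _ => hg z)
    (fun z hz => (hb z).trans (by
      have : ‖z‖ ≤ ‖X‖ := by simpa using hz
      gcongr))
    (by simp) (by simp)
  rw [h0, sub_zero, sub_zero] at h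
  rw [pow_succ, ← mul_assoc]
  exact h

set_option maxSynthPendingDepth 3 in
/-- If a function with bounded third derivative is `O(|X|³)` at the origin and has vanishing first
derivative there, then its second derivative vanishes there too. -/
theorem fderiv_fderiv_eq_zero_of_isBigO {V : Type*} [NormedAddCommGroup V] [NormedSpace ℝ V]
    {r : V → ℂ} (hr : ContDiff ℝ ∞ r) (h0 : r 0 = 0) (h1 : fderiv ℝ r 0 = 0) {C : ℝ}
    (h3 : ∀ X, ‖iteratedFDeriv ℝ 3 r X‖ ≤ C) (hO : r =O[𝓝 0] fun X => ‖X‖ ^ 3) :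
    fderiv ℝ (fderiv ℝ r) 0 = 0 := by
  have hC : 0 ≤ C := (norm_nonneg _).trans (h3 0)
  have hr1 : ContDiff ℝ ∞ (fderiv ℝ r) := hr.fderiv_right (by simp)
  have hr2 : ContDiff ℝ ∞ (fderiv ℝ (fderiv ℝ r)) := hr1.fderiv_right (by simp)
  set M := fderiv ℝ (fderiv ℝ r) 0 with hM
  have hsymm : ∀ v w, M v w = M w v :=
    (hr.contDiffAt (x := (0 : V))).isSymmSndFDerivAt (by
      rw [minSmoothness_of_isRCLikeNormedField]
      exact WithTop.coe_le_coe.2 (le_top : (2 : ℕ∞) ≤ ⊤))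
  have hd2 : ∀ X, ‖fderiv ℝ (fderiv ℝ r) X - M‖ ≤ C * ‖X‖ ^ 1 := by
    intro X
    refine norm_le_of_norm_fderiv_le_pow (g := fun X => fderiv ℝ (fderiv ℝ r) X - M) (n := 0)
      ((hr2.differentiable (by simp)).sub_const M) (by
        ext v w; simp [hM]) hC (fun Y => ?_) X
    have hD : fderiv ℝ (fun X => fderiv ℝ (fderiv ℝ r) X - M) Y
        = fderiv ℝ (fderiv ℝ (fderiv ℝ r)) Y :=
      ((hr2.differentiable (by simp) Y).hasFDerivAt.sub_const M).fderiv
    rw [hD, pow_zero, mul_one, ← norm_iteratedFDeriv_zero (𝕜 := ℝ)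
      (f := fderiv ℝ (fderiv ℝ (fderiv ℝ r))), norm_iteratedFDeriv_fderiv,
      norm_iteratedFDeriv_fderiv, norm_iteratedFDeriv_fderiv]
    exact h3 Y
  have hd1 : ∀ X, ‖fderiv ℝ r X - M X‖ ≤ C * ‖X‖ ^ 2 := by
    intro X
    refine norm_le_of_norm_fderiv_le_pow (g := fun X => fderiv ℝ r X - M X) (n := 1)
      ((hr1.differentiable (by simp)).sub M.differentiable) (by simp [h1]) hC (fun Y => ?_) X
    rw [fderiv_fun_sub (hr1.differentiable (by simp) Y) M.differentiableAt, M.fderiv]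
    exact hd2 Y
  have hd0 : ∀ X, ‖r X - (1 / 2 : ℝ) • M X X‖ ≤ C * ‖X‖ ^ 3 := by
    intro X
    have hq : ∀ Y, HasFDerivAt (fun X => (1 / 2 : ℝ) • M X X) (M Y) Y := by
      intro Y
      have h := (M.hasFDerivAt (x := Y)).clm_apply (hasFDerivAt_id Y)
      refine (h.const_smul (1 / 2 : ℝ)).congr_fderiv ?_
      ext v
      simp [hsymm v Y]
      ring
    refine norm_le_of_norm_fderiv_le_pow (g := fun X => r X - (1 / 2 : ℝ) • M X X) (n := 2)
      ((hr.differentiable (by simp)).sub fun Y => (hq Y).differentiableAt) (by simp [h0]) hC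
      (fun Y => ?_) X
    rw [fderiv_fun_sub (hr.differentiable (by simp) Y) (hq Y).differentiableAt, (hq Y).fderiv]
    exact hd1 Y
  obtain ⟨K, hK⟩ := hO.bound
  -- the quadratic form `M X X` is `O(|X|³)`, hence zero by homogeneity
  have hdiag : ∀ X, M X X = 0 := by
    intro X
    have hlim : Tendsto (fun t : ℝ => t • X) (𝓝[>] 0) (𝓝 0) := by
      have : Tendsto (fun t : ℝ => t • X) (𝓝 0) (𝓝 ((0 : ℝ) • X)) :=
        (continuous_id.smul continuous_const).tendsto 0
      rw [zero_smul] at this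
      exact this.mono_left nhdsWithin_le_nhds
    have hev : ∀ᶠ t : ℝ in 𝓝[>] 0, ‖M X X‖ ≤ t * (2 * (K + C) * ‖X‖ ^ 3) := by
      filter_upwards [hlim.eventually hK, self_mem_nhdsWithin] with t ht ht0
      have ht0 : 0 < t := ht0
      have e := hd0 (t • X)
      have hn : ‖(1 / 2 : ℝ) • M (t • X) (t • X)‖ = t ^ 2 / 2 * ‖M X X‖ := by
        simp [abs_of_pos ht0]
        ring
      have htri : ‖(1 / 2 : ℝ) • M (t • X) (t • X)‖
          ≤ ‖r (t • X)‖ + ‖r (t • X) - (1 / 2 : ℝ) • M (t • X) (t • X)‖ :=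
        norm_le_insert _ _
      rw [norm_pow, norm_norm] at ht
      have hx : ‖t • X‖ = t * ‖X‖ := by rw [norm_smul, Real.norm_of_nonneg ht0.le]
      rw [hx] at ht e
      rw [hn] at htri
      have : t ^ 2 * ‖M X X‖ ≤ t ^ 2 * (t * (2 * (K + C) * ‖X‖ ^ 3)) := by nlinarith
      exact le_of_mul_le_mul_left this (by positivity)
    have hl0 : Tendsto (fun t : ℝ => t * (2 * (K + C) * ‖X‖ ^ 3)) (𝓝[>] 0) (𝓝 0) := by
      have : Tendsto (fun t : ℝ => t * (2 * (K + C) * ‖X‖ ^ 3)) (𝓝 0) (𝓝 (0 * _)) :=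
        tendsto_id.mul_const _
      rw [zero_mul] at this
      exact this.mono_left nhdsWithin_le_nhds
    exact norm_le_zero_iff.mp (ge_of_tendsto hl0 hev)
  ext v w
  have h := hdiag (v + w)
  simp only [map_add, _root_.add_apply, hdiag, hsymm w v, zero_add, add_zero] at h
  simpa using (by linear_combination h / 2 : M v w = 0)

/-- All derivatives of a function vanishing to third order at the origin and having bounded
derivatives of order at least three, in the form used at scale `t`. -/
theorem exists_scaled_bound_of_vanishing {V : Type*} [NormedAddCommGroup V] [NormedSpace ℝ V]
    {r : V → ℂ} (hr : ContDiff ℝ ∞ r) (h0 : r 0 = 0) (h1 : fderiv ℝ r 0 = 0)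
    (hO : r =O[𝓝 0] fun X => ‖X‖ ^ 3)
    (hb : ∀ k, 3 ≤ k → ∃ C, ∀ X, ‖iteratedFDeriv ℝ k r X‖ ≤ C) (k : ℕ) :
    ∃ C : ℝ, ∀ t : ℝ, 0 < t → t ≤ 1 → ∀ X,
      t ^ k * ‖iteratedFDeriv ℝ k r X‖ ≤ C * (t + ‖X‖) ^ 3 := by
  by_cases hk : 3 ≤ k
  · obtain ⟨C, hC⟩ := hb k hk
    refine ⟨C, fun t ht ht1 X => ?_⟩
    have hC0 : 0 ≤ C := (norm_nonneg _).trans (hC X)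
    have h3 : t ^ k ≤ t ^ 3 := pow_le_pow_of_le_one ht.le ht1 hk
    have h4 : t ^ 3 ≤ (t + ‖X‖) ^ 3 := by gcongr; linarith [norm_nonneg X]
    calc t ^ k * ‖iteratedFDeriv ℝ k r X‖ ≤ (t + ‖X‖) ^ 3 * C := by
          gcongr
          · exact h3.trans h4
          · exact hC X
      _ = _ := mul_comm _ _
  · obtain ⟨C, hC⟩ := hb 3 le_rfl
    have hC0 : 0 ≤ C := (norm_nonneg _).trans (hC 0)
    have h2 := fderiv_fderiv_eq_zero_of_isBigO hr h0 h1 hC hO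
    have hdiff : ∀ j : ℕ, Differentiable ℝ (iteratedFDeriv ℝ j r) := fun j =>
      hr.differentiable_iteratedFDeriv (by exact_mod_cast ENat.natCast_lt_top j)
    have hz : ∀ j < 3, iteratedFDeriv ℝ j r 0 = 0 := by
      intro j hj
      rw [← norm_eq_zero]
      interval_cases j
      · simp [h0]
      · rw [← norm_iteratedFDeriv_fderiv, norm_iteratedFDeriv_zero, h1, norm_zero]
      · rw [← norm_iteratedFDeriv_fderiv, ← norm_iteratedFDeriv_fderiv,
          norm_iteratedFDeriv_zero, h2, norm_zero]
    have hstep : ∀ j < 3, ∀ n, (∀ X, ‖iteratedFDeriv ℝ (j + 1) r X‖ ≤ C * ‖X‖ ^ n) →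
        ∀ X, ‖iteratedFDeriv ℝ j r X‖ ≤ C * ‖X‖ ^ (n + 1) := fun j hj n h =>
      norm_le_of_norm_fderiv_le_pow (hdiff j) (hz j hj) hC0 fun X => by
        rw [norm_fderiv_iteratedFDeriv]
        exact h X
    have b2 := hstep 2 (by norm_num) 0 fun X => by simpa using hC X
    have b1 := hstep 1 (by norm_num) _ b2
    have b0 := hstep 0 (by norm_num) _ b1
    have hall : ∀ X, ‖iteratedFDeriv ℝ k r X‖ ≤ C * ‖X‖ ^ (3 - k) := by
      push Not at hk
      interval_cases k
      · exact b0
      · exact b1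
      · exact b2
    refine ⟨C, fun t ht ht1 X => ?_⟩
    have hX := norm_nonneg X
    calc t ^ k * ‖iteratedFDeriv ℝ k r X‖
        ≤ (t + ‖X‖) ^ k * (C * (t + ‖X‖) ^ (3 - k)) := by
          gcongr
          · linarith
          · refine (hall X).trans ?_
            gcongr
            linarith
      _ = C * (t + ‖X‖) ^ 3 := by
          have : (t + ‖X‖) ^ 3 = (t + ‖X‖) ^ k * (t + ‖X‖) ^ (3 - k) := by
            rw [← pow_add]; congr 1; omega
          rw [this]
          ring

/-- The derivative of a quadratic map on a finite-dimensional space is linear. -/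
theorem exists_hasFDerivAt_quadraticMap {V : Type*} [NormedAddCommGroup V] [NormedSpace ℝ V]
    [FiniteDimensional ℝ V] (q : QuadraticMap ℝ V ℂ) :
    ∃ A : V →L[ℝ] V →L[ℝ] ℂ, ∀ X, HasFDerivAt q (A X) X := by
  let A : V →L[ℝ] V →L[ℝ] ℂ :=
    LinearMap.toContinuousLinearMap
      ((LinearMap.toContinuousLinearMap : (V →ₗ[ℝ] ℂ) ≃ₗ[ℝ] V →L[ℝ] ℂ).toLinearMap ∘ₗ q.polarBilin)
  have hA : ∀ X Y, A X Y = QuadraticMap.polar q X Y := fun X Y => rfl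
  refine ⟨A, fun X => ?_⟩
  have hsymm : ∀ X Y, A X Y = A Y X := fun X Y => by
    rw [hA, hA, QuadraticMap.polar_comm]
  have e : ⇑q = fun X => (1 / 2 : ℝ) • A X X := by
    funext X
    rw [hA, QuadraticMap.polar_self, two_nsmul, ← two_smul ℝ, smul_smul]
    norm_num
  rw [e]
  have h := (A.hasFDerivAt (x := X)).clm_apply (hasFDerivAt_id X)
  refine (h.const_smul (1 / 2 : ℝ)).congr_fderiv ?_
  ext v
  simp [hsymm v X]
  ring

theorem contDiff_quadraticMap {V : Type*} [NormedAddCommGroup V] [NormedSpace ℝ V]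
    [FiniteDimensional ℝ V] (q : QuadraticMap ℝ V ℂ) : ContDiff ℝ ∞ q := by
  obtain ⟨A, hA⟩ := exists_hasFDerivAt_quadraticMap q
  rw [contDiff_infty_iff_fderiv]
  refine ⟨fun X => (hA X).differentiableAt, ?_⟩
  have : fderiv ℝ q = A := funext fun X => (hA X).fderiv
  rw [this]
  exact A.contDiff

theorem iteratedFDeriv_quadraticMap_eq_zero {V : Type*} [NormedAddCommGroup V] [NormedSpace ℝ V]
    [FiniteDimensional ℝ V] (q : QuadraticMap ℝ V ℂ) {k : ℕ} (hk : 3 ≤ k) (X : V) :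
    iteratedFDeriv ℝ k q X = 0 := by
  obtain ⟨A, hA⟩ := exists_hasFDerivAt_quadraticMap q
  obtain ⟨k, rfl⟩ := Nat.exists_eq_add_of_le' hk
  have h1 : fderiv ℝ q = A := funext fun X => (hA X).fderiv
  have h2 : fderiv ℝ A = fun _ => A := funext fun X => A.fderiv
  rw [← norm_eq_zero, ← norm_iteratedFDeriv_fderiv, h1, ← norm_iteratedFDeriv_fderiv, h2,
    iteratedFDeriv_const_of_ne (by omega)]
  simp

theorem IsDoublyCharacteristic.exists_scaled_bound_sub {d : ℕ} {p : RSpace d × RSpace d → ℂ}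
    {q : QuadraticMap ℝ (RSpace d × RSpace d) ℂ} (hpq : IsDoublyCharacteristic p q) (k : ℕ) :
    ∃ C : ℝ, ∀ t : ℝ, 0 < t → t ≤ 1 → ∀ X,
      t ^ k * ‖iteratedFDeriv ℝ k (fun X => p X - q X) X‖ ≤ C * (t + ‖X‖) ^ 3 := by
  have hq := contDiff_quadraticMap q
  have hp := hpq.symbol.1
  refine exists_scaled_bound_of_vanishing (hp.sub hq) ?_ ?_ hpq.quadratic_part (fun k hk => ?_) k
  · simp [hpq.value_zero]
  · obtain ⟨A, hA⟩ := exists_hasFDerivAt_quadraticMap q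
    rw [fderiv_fun_sub (hp.differentiable (by simp) 0) (hA 0).differentiableAt, hpq.deriv_zero,
      (hA 0).fderiv, map_zero, sub_zero]
  · obtain ⟨C, hC⟩ := hpq.symbol.2 k
    refine ⟨C, fun X => ?_⟩
    have hk' : (k : ℕ∞ω) ≤ ∞ := by exact_mod_cast le_top
    have e : iteratedFDeriv ℝ k (fun X => p X - q X) X
        = iteratedFDeriv ℝ k p X - iteratedFDeriv ℝ k q X :=
      iteratedFDeriv_sub_apply (hp.of_le hk').contDiffAt (hq.of_le hk').contDiffAt
    rw [e, iteratedFDeriv_quadraticMap_eq_zero q hk, sub_zero]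
    exact hC X

/-! ### Amplitudes -/

theorem norm_reVec_le {d : ℕ} (z : CSpace d) : ‖reVec z‖ ≤ ‖z‖ := by
  rw [EuclideanSpace.norm_eq, EuclideanSpace.norm_eq]
  refine Real.sqrt_le_sqrt (Finset.sum_le_sum fun j _ => ?_)
  have : ‖(z j).re‖ ≤ ‖z j‖ := Complex.abs_re_le_norm _
  simp only [reVec]
  gcongr

theorem norm_imVec_le {d : ℕ} (z : CSpace d) : ‖imVec z‖ ≤ ‖z‖ := by
  rw [EuclideanSpace.norm_eq, EuclideanSpace.norm_eq]
  refine Real.sqrt_le_sqrt (Finset.sum_le_sum fun j _ => ?_)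
  have : ‖(z j).im‖ ≤ ‖z j‖ := Complex.abs_im_le_norm _
  simp only [imVec]
  gcongr

/-- The real-linear identification `z ↦ κ_T⁻¹ (z, -Im z) = (Re z, -Im z)` of `ℂ^d` with the real
phase space. -/
def phaseMap (d : ℕ) : CSpace d →L[ℝ] RSpace d × RSpace d :=
  LinearMap.mkContinuous
    { toFun := fun z => (reVec z, -imVec z)
      map_add' := fun a b => by
        ext j <;> simp [reVec, imVec]
        ring
      map_smul' := fun r a => by ext j <;> simp [reVec, imVec] } 1 (fun z => by
        rw [one_mul]
        simpa [Prod.norm_def] using ⟨norm_reVec_le z, norm_imVec_le z⟩)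

theorem norm_phaseMap_le (d : ℕ) : ‖phaseMap d‖ ≤ 1 :=
  LinearMap.mkContinuous_norm_le _ zero_le_one _

theorem norm_phaseMap_apply_le {d : ℕ} (z : CSpace d) : ‖phaseMap d z‖ ≤ ‖z‖ := by
  simpa using (phaseMap d).le_of_opNorm_le (norm_phaseMap_le d) z

theorem fbiSymbol_xi0 {d : ℕ} (a : RSpace d × RSpace d → ℂ) (z : CSpace d) :
    fbiSymbol a (z, xi0 z) = a (phaseMap d z) := by
  have : kappaTInv (z, xi0 z) = phaseMap d z := by
    show kappaTInv (z, xi0 z) = (reVec z, -imVec z)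
    ext j <;> simp [kappaTInv, reVec, imVec, xi0, ofRealVec]
  rw [fbiSymbol, this]

/-- The symbol along the contour, at scale `t` around `x`, times a further factor `ψ`. -/
def amplitude {d : ℕ} (t : ℝ) (a : RSpace d × RSpace d → ℂ) (x : CSpace d) (ψ : CSpace d → ℂ)
    (s : CSpace d) : ℂ :=
  ψ s * a (phaseMap d (x + t • s))

/-- Derivatives of `a` of order at most `n`, measured at scale `t`, are bounded by
`A (t + |X|)³`. -/
def ScaledBound {d : ℕ} (n : ℕ) (t A : ℝ) (a : RSpace d × RSpace d → ℂ) : Prop :=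
  ∀ k ≤ n, ∀ X, t ^ k * ‖iteratedFDeriv ℝ k a X‖ ≤ A * (t + ‖X‖) ^ 3

theorem contDiff_symbol_along {d : ℕ} {a : RSpace d × RSpace d → ℂ} (ha : ContDiff ℝ ∞ a) (t : ℝ)
    (x : CSpace d) : ContDiff ℝ ∞ fun s => a (phaseMap d (x + t • s)) :=
  ha.comp ((phaseMap d).contDiff.comp (by fun_prop))

theorem contDiff_amplitude {d : ℕ} {a : RSpace d × RSpace d → ℂ} (ha : ContDiff ℝ ∞ a) (t : ℝ)
    (x : CSpace d) {ψ : CSpace d → ℂ} (hψ : ContDiff ℝ ∞ ψ) :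
    ContDiff ℝ ∞ (amplitude t a x ψ) :=
  hψ.mul (contDiff_symbol_along ha t x)

theorem ScaledBound.nonneg {d n : ℕ} {t A : ℝ} {a : RSpace d × RSpace d → ℂ} (ht : 0 < t)
    (hA : ScaledBound n t A a) : 0 ≤ A := by
  have h := hA 0 (Nat.zero_le n) 0
  rw [norm_zero, add_zero] at h
  exact nonneg_of_mul_nonneg_left (le_trans (by positivity) h) (by positivity)

theorem norm_iteratedFDeriv_symbol_along_le {d n : ℕ} {a : RSpace d × RSpace d → ℂ}
    (ha : ContDiff ℝ ∞ a) {t A : ℝ} (ht : 0 < t) (hA : ScaledBound n t A a) (x s : CSpace d)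
    {k : ℕ} (hk : k ≤ n) :
    ‖iteratedFDeriv ℝ k (fun s => a (phaseMap d (x + t • s))) s‖
      ≤ A * ((t + ‖x‖) ^ 3 * (1 + ‖s‖) ^ 3) := by
  have hA0 := hA.nonneg ht
  have hk' : (k : ℕ∞ω) ≤ ∞ := by exact_mod_cast le_top
  have hg : ContDiff ℝ ∞ (a ∘ phaseMap d) := ha.comp (phaseMap d).contDiff
  have hg' : ContDiff ℝ k fun z => (a ∘ phaseMap d) (x + z) :=
    (hg.comp (contDiff_const.add contDiff_id)).of_le hk'
  have e : iteratedFDeriv ℝ k (fun s => a (phaseMap d (x + t • s))) s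
      = t ^ k • iteratedFDeriv ℝ k (a ∘ phaseMap d) (x + t • s) := by
    have h1 := congrFun (iteratedFDeriv_comp_const_smul (i := k) t hg') s
    rw [iteratedFDeriv_comp_add_left] at h1
    exact h1
  rw [e, norm_smul, Real.norm_of_nonneg (by positivity),
    (phaseMap d).iteratedFDeriv_comp_right ha _ hk']
  have h2 := ContinuousMultilinearMap.norm_compContinuousLinearMap_le
    (iteratedFDeriv ℝ k a (phaseMap d (x + t • s))) fun _ : Fin k => phaseMap d
  have h3 : ∏ _i : Fin k, ‖phaseMap d‖ ≤ 1 :=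
    Finset.prod_le_one (fun _ _ => norm_nonneg _) fun _ _ => norm_phaseMap_le d
  have hs := norm_nonneg s
  have hx := norm_nonneg x
  have hn : ‖phaseMap d (x + t • s)‖ ≤ ‖x‖ + t * ‖s‖ := by
    refine (norm_phaseMap_apply_le _).trans ((norm_add_le _ _).trans_eq ?_)
    rw [norm_smul, Real.norm_of_nonneg ht.le]
  calc t ^ k * ‖(iteratedFDeriv ℝ k a (phaseMap d (x + t • s))).compContinuousLinearMap
          fun _ => phaseMap d‖
      ≤ t ^ k * ‖iteratedFDeriv ℝ k a (phaseMap d (x + t • s))‖ := by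
        gcongr
        exact h2.trans (mul_le_of_le_one_right (norm_nonneg _) h3)
    _ ≤ A * (t + ‖phaseMap d (x + t • s)‖) ^ 3 := hA k hk _
    _ ≤ A * ((t + ‖x‖) * (1 + ‖s‖)) ^ 3 := by
        gcongr
        nlinarith [mul_nonneg hx hs]
    _ = _ := by rw [mul_pow]

theorem derivBound_amplitude {d n : ℕ} {a : RSpace d × RSpace d → ℂ} (ha : ContDiff ℝ ∞ a)
    {t A K : ℝ} (ht : 0 < t) (hA : ScaledBound n t A a) (x s : CSpace d) {ψ : CSpace d → ℂ}
    (hψ : ContDiff ℝ ∞ ψ) (hK : ∀ i ≤ n, ‖iteratedFDeriv ℝ i ψ s‖ ≤ K) :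
    DerivBound n (amplitude t a x ψ) s
      (2 ^ n * (K * (A * (t + ‖x‖) ^ 3)) * (1 + ‖s‖) ^ (n + 3)) := by
  intro j hj
  have hA0 := hA.nonneg ht
  have hK0 : 0 ≤ K := (norm_nonneg _).trans (hK 0 (Nat.zero_le n))
  have hs : 1 ≤ 1 + ‖s‖ := by linarith [norm_nonneg s]
  have h := norm_iteratedFDeriv_mul_le hψ (contDiff_symbol_along ha t x) s (n := j)
    (by exact_mod_cast le_top)
  have h2 : ‖iteratedFDeriv ℝ j (amplitude t a x ψ) s‖
      ≤ 2 ^ j * (K * (A * ((t + ‖x‖) ^ 3 * (1 + ‖s‖) ^ 3))) := by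
    refine h.trans ?_
    calc _ ≤ ∑ i ∈ Finset.range (j + 1),
            (j.choose i : ℝ) * (K * (A * ((t + ‖x‖) ^ 3 * (1 + ‖s‖) ^ 3))) := by
          refine Finset.sum_le_sum fun i hi => ?_
          have hi' : i ≤ j := by simpa [Nat.lt_succ_iff] using hi
          rw [mul_assoc]
          gcongr
          · exact hK i (hi'.trans hj)
          · exact norm_iteratedFDeriv_symbol_along_le ha ht hA x s (by omega)
      _ = _ := by
          rw [← Finset.sum_mul]
          have : (∑ i ∈ Finset.range (j + 1), (j.choose i : ℝ)) = 2 ^ j := by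
            exact_mod_cast Nat.sum_range_choose j
          rw [this]
  calc (1 + ‖s‖) ^ j * ‖iteratedFDeriv ℝ j (amplitude t a x ψ) s‖
      ≤ (1 + ‖s‖) ^ n * (2 ^ n * (K * (A * ((t + ‖x‖) ^ 3 * (1 + ‖s‖) ^ 3)))) := by
        gcongr
        · exact h2.trans (by gcongr; norm_num)
    _ = _ := by rw [pow_add]; ring

/-- The integrable weight `(1 + |s|)^{-(2d+1)}` on `ℂ^d`. -/
def decay {d : ℕ} (s : CSpace d) : ℝ := (1 + ‖s‖) ^ (-(2 * d + 1 : ℝ))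

theorem decay_nonneg {d : ℕ} (s : CSpace d) : 0 ≤ decay s := by unfold decay; positivity

theorem decay_le_one {d : ℕ} (s : CSpace d) : decay s ≤ 1 :=
  Real.rpow_le_one_of_one_le_of_nonpos (by linarith [norm_nonneg s]) (by
    have : (0 : ℝ) ≤ d := Nat.cast_nonneg d
    linarith)

theorem continuous_decay {d : ℕ} : Continuous (decay (d := d)) :=
  (continuous_const.add continuous_norm).rpow_const fun s =>
    Or.inl (add_pos_of_pos_of_nonneg one_pos (norm_nonneg s)).ne'

theorem finrank_real_CSpace (d : ℕ) : Module.finrank ℝ (CSpace d) = 2 * d := by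
  have h := finrank_real_of_complex (CSpace d)
  simpa using h

theorem integrable_decay {d : ℕ} : Integrable (decay (d := d)) := by
  refine integrable_one_add_norm ?_
  rw [finrank_real_CSpace]
  push_cast
  linarith

/-- With `2 d + 4` integrations by parts the amplitude decays integrably. -/
theorem exists_norm_iterate_amplitude_le (d : ℕ) :
    ∃ C : ℝ, 0 ≤ C ∧ ∀ {a : RSpace d × RSpace d → ℂ} {t A K : ℝ} {x s : CSpace d}
      {ψ : CSpace d → ℂ}, ContDiff ℝ ∞ a → 0 < t → ScaledBound (2 * d + 4) t A a →
      ContDiff ℝ ∞ ψ → (∀ i ≤ 2 * d + 4, ‖iteratedFDeriv ℝ i ψ s‖ ≤ K) →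
      ‖transOp^[2 * d + 4] (amplitude t a x ψ) s‖ ≤ C * (K * (A * (t + ‖x‖) ^ 3)) * decay s := by
  obtain ⟨C, hC, h⟩ := exists_norm_iterate_transOp_le_of_derivBound d (2 * d + 4)
  refine ⟨C * 4 ^ (2 * d + 4), by positivity, fun {a t A K x s ψ} ha ht hA hψ hK => ?_⟩
  have hA0 := hA.nonneg ht
  have hK0 : 0 ≤ K := (norm_nonneg _).trans (hK 0 (Nat.zero_le _))
  have hw : 0 < 1 + ‖s‖ := by positivity
  refine (h (contDiff_amplitude ha t x hψ) (derivBound_amplitude ha ht hA x s hψ hK)).trans ?_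
  -- `(1 + |s|)² ≤ 2 (1 + |s|²)`
  have h1 : (1 + ‖s‖ ^ 2)⁻¹ ≤ 2 * ((1 + ‖s‖) ^ 2)⁻¹ := by
    rw [← div_eq_mul_inv, inv_eq_one_div, div_le_div_iff₀ (one_add_norm_sq_pos s) (by positivity)]
    nlinarith [sq_nonneg (1 - ‖s‖)]
  have hd : decay s = ((1 + ‖s‖) ^ (2 * d + 1))⁻¹ := by
    rw [decay, Real.rpow_neg hw.le, ← Real.rpow_natCast]
    push_cast
    rfl
  calc C * ((1 + ‖s‖ ^ 2)⁻¹ ^ (2 * d + 4) *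
        (2 ^ (2 * d + 4) * (K * (A * (t + ‖x‖) ^ 3)) * (1 + ‖s‖) ^ (2 * d + 4 + 3)))
      ≤ C * ((2 * ((1 + ‖s‖) ^ 2)⁻¹) ^ (2 * d + 4) *
        (2 ^ (2 * d + 4) * (K * (A * (t + ‖x‖) ^ 3)) * (1 + ‖s‖) ^ (2 * d + 4 + 3))) := by
        gcongr
    _ = C * 4 ^ (2 * d + 4) * (K * (A * (t + ‖x‖) ^ 3)) * decay s := by
        have e4 : (4 : ℝ) ^ (2 * d + 4) = 2 ^ (2 * d + 4) * 2 ^ (2 * d + 4) := by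
          rw [← mul_pow]; norm_num
        have ew : (((1 + ‖s‖) ^ 2)⁻¹) ^ (2 * d + 4) * (1 + ‖s‖) ^ (2 * d + 4 + 3)
            = ((1 + ‖s‖) ^ (2 * d + 1))⁻¹ := by
          rw [inv_pow, inv_mul_eq_div, div_eq_iff (by positivity), eq_comm, inv_mul_eq_div,
            div_eq_iff (by positivity), ← pow_mul, ← pow_add]
          congr 1
          ring
        rw [hd, ← ew, mul_pow, e4]
        ring

/-! ### The weighted space -/

/-- The function `e^{-Φ₀/h} |u|`, whose norm in `L²(dL)` is the norm of `u` in `L²_{Φ₀}`. -/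
def weightedAbs {d : ℕ} (h : ℝ) (u : CSpace d → ℂ) (y : CSpace d) : ℝ :=
  Real.exp (-(Phi0 y / h)) * ‖u y‖

theorem continuous_Phi0 {d : ℕ} : Continuous (Phi0 (d := d)) := by
  have e : Phi0 (d := d) = fun x => (∑ j, (x j).im ^ 2) / 2 := funext Phi0_eq_sum
  rw [e]
  fun_prop

theorem continuous_weightedAbs {d : ℕ} {u : CSpace d → ℂ} (hu : Continuous u) (h : ℝ) :
    Continuous (weightedAbs h u) :=
  (Real.continuous_exp.comp (continuous_Phi0.div_const h).neg).mul hu.norm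

theorem weightedAbs_nonneg {d : ℕ} (h : ℝ) (u : CSpace d → ℂ) (y : CSpace d) :
    0 ≤ weightedAbs h u y := by unfold weightedAbs; positivity

theorem eLpNorm_weightedMeasure {d : ℕ} (h : ℝ) (u : CSpace d → ℂ) :
    eLpNorm u 2 (weightedMeasure d h) = (∫⁻ y, ‖weightedAbs h u y‖ₑ ^ 2) ^ (1 / 2 : ℝ) := by
  have hm : Measurable fun x : CSpace d => ENNReal.ofReal (Real.exp (-(2 / h) * Phi0 x)) :=
    (Real.continuous_exp.comp (continuous_const.mul continuous_Phi0)).measurable.ennreal_ofReal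
  rw [eLpNorm_eq_lintegral_rpow_enorm_toReal (by norm_num) (by norm_num), weightedMeasure,
    lintegral_withDensity_eq_lintegral_mul_non_measurable _ hm
      (Eventually.of_forall fun x => ENNReal.ofReal_lt_top)]
  norm_num
  congr 1
  refine lintegral_congr fun y => ?_
  have e : Real.exp (-(2 / h * Phi0 y)) = Real.exp (-(Phi0 y / h)) ^ 2 := by
    rw [← Real.exp_nat_mul]
    congr 1
    push_cast
    ring
  rw [e, weightedAbs, enorm_mul, mul_pow, enorm_norm, Real.enorm_of_nonneg (Real.exp_pos _).le,
    ENNReal.ofReal_pow (Real.exp_pos _).le]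

theorem lintegral_weightedAbs_sq_lt_top {d : ℕ} {h : ℝ} {u : CSpace d → ℂ} (hu : MemH h u) :
    ∫⁻ y, ‖weightedAbs h u y‖ₑ ^ 2 < ⊤ := by
  have h2 := hu.2.eLpNorm_lt_top
  rw [eLpNorm_weightedMeasure] at h2
  by_contra hc
  rw [not_lt_top_iff.mp hc] at h2
  simp at h2

theorem integrable_weightedAbs_sq {d : ℕ} {h : ℝ} {u : CSpace d → ℂ} (hu : MemH h u) :
    Integrable fun y => weightedAbs h u y ^ 2 := by
  refine ⟨((continuous_weightedAbs hu.1.continuous h).pow 2).aestronglyMeasurable, ?_⟩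
  rw [hasFiniteIntegral_iff_enorm]
  simpa [enorm_pow] using lintegral_weightedAbs_sq_lt_top hu

theorem integrable_decay_mul_weightedAbs {d : ℕ} {h t : ℝ} (ht : 0 < t) {u : CSpace d → ℂ}
    (hu : MemH h u) (x : CSpace d) :
    Integrable fun s => decay s * weightedAbs h u (x + (2 * t) • s) := by
  have c1 : Continuous fun s => weightedAbs h u (x + (2 * t) • s) :=
    (continuous_weightedAbs hu.1.continuous h).comp (by fun_prop)
  have h1 : Integrable fun s => weightedAbs h u (x + (2 * t) • s) ^ 2 :=
    ((integrable_weightedAbs_sq hu).comp_add_left x).comp_smul (by positivity)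
  refine (integrable_decay.add h1).mono' (continuous_decay.mul c1).aestronglyMeasurable
    (Eventually.of_forall fun s => ?_)
  have hd0 := decay_nonneg s
  have hd1 := decay_le_one s
  have hw := weightedAbs_nonneg h u (x + (2 * t) • s)
  rw [Real.norm_of_nonneg (by positivity)]
  simp only [Pi.add_apply]
  -- `a b ≤ a² + b²` and `a² ≤ a`
  nlinarith [sq_nonneg (decay s - weightedAbs h u (x + (2 * t) • s)), mul_nonneg hd0 hw]

theorem norm_weylFactor_eq {d : ℕ} (u : CSpace d → ℂ) {h t : ℝ} (ht : 0 < t) (hth : t ^ 2 = h)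
    (x s : CSpace d) :
    ‖weylFactor t x u s‖ = Real.exp (Phi0 x / h) * weightedAbs h u (x + (2 * t) • s) := by
  rw [norm_weylFactor u ht, hth, weightedAbs]

/-! ### The Weyl quantization as an absolutely convergent integral -/

/-- The value of the oscillatory integral, in the absolutely convergent form obtained by `2 d + 4`
integrations by parts; here `t = h^{1/2}`. -/
def weylValue {d : ℕ} (t : ℝ) (a : RSpace d × RSpace d → ℂ) (u : CSpace d → ℂ) (x : CSpace d) : ℂ :=
  (Real.pi : ℂ)⁻¹ ^ d *
    ∫ s, transOp^[2 * d + 4] (amplitude t a x fun _ => 1) s * weylFactor t x u s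

theorem integral_comp_translate_dilate {d : ℕ} (F : CSpace d → ℂ) {t : ℝ} (ht : 0 < t)
    (x : CSpace d) : ∫ y, F y = ((2 * t : ℝ) : ℂ) ^ (2 * d) * ∫ s, F (x + (2 * t) • s) := by
  have h1 := Measure.integral_comp_smul (volume : Measure (CSpace d)) (fun y => F (x + y)) (2 * t)
  rw [integral_add_left_eq_self, finrank_real_CSpace, abs_of_nonneg (by positivity)] at h1
  rw [h1, Complex.real_smul]
  push_cast
  have : (2 * (t : ℂ)) ^ (2 * d) ≠ 0 := by
    have : (t : ℂ) ≠ 0 := by exact_mod_cast ht.ne'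
    exact pow_ne_zero _ (mul_ne_zero two_ne_zero this)
  field_simp

theorem truncatedWeyl_eq {d : ℕ} {h t : ℝ} (ht : 0 < t) (hth : t ^ 2 = h)
    (a : RSpace d × RSpace d → ℂ) (u χ : CSpace d → ℂ) (δ : ℝ) (x : CSpace d) :
    truncatedWeyl h (fbiSymbol a) u χ δ x = (Real.pi : ℂ)⁻¹ ^ d *
      ∫ s, amplitude t a x (fun s => χ ((-(2 * δ * t)) • s)) s * weylFactor t x u s := by
  have ht0 : (t : ℂ) ≠ 0 := by exact_mod_cast ht.ne'
  have hpi : (Real.pi : ℂ) ≠ 0 := by exact_mod_cast Real.pi_ne_zero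
  rw [truncatedWeyl, integral_comp_translate_dilate _ ht x, ← mul_assoc,
    ← integral_const_mul, ← integral_const_mul]
  refine integral_congr_ae (Eventually.of_forall fun s => ?_)
  have e1 : ((δ : ℂ) • (x - (x + (2 * t) • s)) : CSpace d) = (-(2 * δ * t)) • s := by
    ext j; simp; ring
  have e2 : ((1 / 2 : ℂ) • (x + (x + (2 * t) • s)) : CSpace d) = x + t • s := by
    ext j; simp; ring
  have e3 : Complex.I / (h : ℂ) * ∑ j, (x j - (x + (2 * t) • s : CSpace d) j)
      * contourTheta x (x + (2 * t) • s) j = weylExponent t x s := by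
    rw [weylExponent, Finset.mul_sum, Finset.mul_sum]
    refine Finset.sum_congr rfl fun j _ => ?_
    rw [contourTheta, e2, ← hth]
    simp [xi0, ofRealVec, imVec]
    field_simp
    ring
  have e4 : contourTheta x (x + (2 * t) • s) = xi0 (x + t • s) := by rw [contourTheta, e2]
  have e5 : ((2 * Real.pi * h : ℝ) : ℂ)⁻¹ ^ d * ((2 * t : ℝ) : ℂ) ^ (2 * d) * (1 / 2 : ℂ) ^ d
      = (Real.pi : ℂ)⁻¹ ^ d := by
    rw [pow_mul, ← mul_pow, ← mul_pow, ← hth]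
    congr 1
    push_cast
    field_simp
  simp only [e3]
  simp only [e1, e2, e4, fbiSymbol_xi0]
  rw [amplitude, weylFactor, ← e5]
  ring

theorem continuous_weylFactor {d : ℕ} {u : CSpace d → ℂ} (hu : Differentiable ℂ u) (t : ℝ)
    (x : CSpace d) : Continuous (weylFactor t x u) :=
  (differentiable_weylFactor hu t x).continuous

theorem norm_iteratedFDeriv_one_le {d : ℕ} (i : ℕ) (s : CSpace d) :
    ‖iteratedFDeriv ℝ i (fun _ : CSpace d => (1 : ℂ)) s‖ ≤ 1 := by
  rcases Nat.eq_zero_or_pos i with rfl | hi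
  · simp
  · rw [iteratedFDeriv_const_of_ne hi.ne']
    simp

theorem exists_bound_iteratedFDeriv_cutoff {d : ℕ} {χ : CSpace d → ℂ} (hχ : IsCutoff χ) (n : ℕ) :
    ∃ K : ℝ, ∀ i ≤ n, ∀ z, ‖iteratedFDeriv ℝ i χ z‖ ≤ K := by
  have h : ∀ i : ℕ, ∃ K : ℝ, ∀ z, ‖iteratedFDeriv ℝ i χ z‖ ≤ K := fun i =>
    (hχ.2.1.iteratedFDeriv i).exists_bound_of_continuous
      (hχ.1.continuous_iteratedFDeriv (by exact_mod_cast le_top))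
  choose K hK using h
  refine ⟨∑ i ∈ Finset.range (n + 1), |K i|, fun i hi z => ?_⟩
  exact ((hK i z).trans (le_abs_self _)).trans
    (Finset.single_le_sum (f := fun i => |K i|) (fun _ _ => abs_nonneg _)
      (Finset.mem_range.mpr (by omega)))

theorem norm_iteratedFDeriv_comp_smul_le {d : ℕ} {χ : CSpace d → ℂ} (hχ : ContDiff ℝ ∞ χ) {c K : ℝ}
    (hc : |c| ≤ 1) {i : ℕ} (hK : ∀ z, ‖iteratedFDeriv ℝ i χ z‖ ≤ K) (s : CSpace d) :
    ‖iteratedFDeriv ℝ i (fun s => χ (c • s)) s‖ ≤ K := by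
  rw [iteratedFDeriv_comp_const_smul c (hχ.of_le (by exact_mod_cast le_top)), norm_smul, norm_pow,
    Real.norm_eq_abs]
  exact (mul_le_of_le_one_left (norm_nonneg _) (pow_le_one₀ (abs_nonneg _) hc)).trans (hK _)

/-- The truncated integrals converge to the absolutely convergent one, for every cutoff: they are
integrated by parts, and the integrands obtained converge dominatedly. -/
theorem isWeyl_weylValue {d : ℕ} {h t A : ℝ} (ht : 0 < t) (hth : t ^ 2 = h)
    {a : RSpace d × RSpace d → ℂ} (ha : ContDiff ℝ ∞ a) (hA : ScaledBound (2 * d + 4) t A a)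
    {u : CSpace d → ℂ} (hu : MemH h u) : IsWeyl h (fbiSymbol a) u (weylValue t a u) := by
  intro χ hχ x
  obtain ⟨K, hK⟩ := exists_bound_iteratedFDeriv_cutoff hχ (2 * d + 4)
  obtain ⟨C, hC, hT⟩ := exists_norm_iterate_amplitude_le d
  have hψ : ∀ δ : ℝ, ContDiff ℝ ∞ fun s : CSpace d => χ ((-(2 * δ * t)) • s) := fun δ =>
    hχ.1.comp (by fun_prop)
  have hcomp : ∀ δ : ℝ, 0 < δ →
      HasCompactSupport (amplitude t a x fun s => χ ((-(2 * δ * t)) • s)) := fun δ hδ =>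
    (hχ.2.1.comp_smul (c := -(2 * δ * t)) (by have := mul_pos hδ ht; nlinarith)).mul_right
  have e : ∀ᶠ δ : ℝ in 𝓝[>] 0, (Real.pi : ℂ)⁻¹ ^ d *
      ∫ s, transOp^[2 * d + 4] (amplitude t a x fun s => χ ((-(2 * δ * t)) • s)) s
        * weylFactor t x u s = truncatedWeyl h (fbiSymbol a) u χ δ x := by
    filter_upwards [self_mem_nhdsWithin] with δ hδ
    rw [truncatedWeyl_eq ht hth, integral_iterate_transOp_mul (contDiff_amplitude ha t x (hψ δ))
      (hcomp δ hδ) (differentiable_weylFactor hu.1 t x)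
      (locallyIntegrable_fderiv_weylFactor hu.1 t x) (dbarEuler_weylFactor hu.1 t x)]
  refine Tendsto.congr' e (Tendsto.const_mul _ ?_)
  have hc0 : Tendsto (fun δ : ℝ => -(2 * δ * t)) (𝓝[>] 0) (𝓝 0) := by
    have : Tendsto (fun δ : ℝ => -(2 * δ * t)) (𝓝 0) (𝓝 (-(2 * 0 * t))) :=
      Continuous.tendsto (by fun_prop) 0
    rw [mul_zero, zero_mul, neg_zero] at this
    exact this.mono_left nhdsWithin_le_nhds
  have hc1 : ∀ᶠ δ : ℝ in 𝓝[>] 0, |-(2 * δ * t)| ≤ 1 := by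
    have := hc0.eventually (Metric.closedBall_mem_nhds (0 : ℝ) one_pos)
    filter_upwards [this] with δ hδ
    simpa using hδ
  refine tendsto_integral_filter_of_dominated_convergence
    (fun s => C * (K * (A * (t + ‖x‖) ^ 3)) * Real.exp (Phi0 x / h) *
      (decay s * weightedAbs h u (x + (2 * t) • s))) ?_ ?_ ?_ ?_
  · exact Eventually.of_forall fun δ =>
      ((contDiff_iterate_transOp (contDiff_amplitude ha t x (hψ δ)) _).continuous.mul
        (continuous_weylFactor hu.1 t x)).aestronglyMeasurable
  · filter_upwards [hc1] with δ hδ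
    refine Eventually.of_forall fun s => ?_
    rw [norm_mul, norm_weylFactor_eq u ht hth]
    have hb := hT (s := s) (x := x) ha ht hA (hψ δ) fun i hi =>
      norm_iteratedFDeriv_comp_smul_le hχ.1 hδ (hK i hi) s
    have hw := weightedAbs_nonneg h u (x + (2 * t) • s)
    calc _ ≤ C * (K * (A * (t + ‖x‖) ^ 3)) * decay s *
          (Real.exp (Phi0 x / h) * weightedAbs h u (x + (2 * t) • s)) := by gcongr
      _ = _ := by ring
  · exact (integrable_decay_mul_weightedAbs ht hu x).const_mul _
  · refine Eventually.of_forall fun s => ?_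
    -- near `s` the cutoff factor is eventually `1`, and the transposed operator is local
    have hloc : ∀ᶠ δ : ℝ in 𝓝[>] 0, (fun s : CSpace d => χ ((-(2 * δ * t)) • s)) =ᶠ[𝓝 s]
        fun _ => 1 := by
      have h1 : Tendsto (fun δ : ℝ => (-(2 * δ * t)) • s) (𝓝[>] 0) (𝓝 0) := by
        simpa using hc0.smul_const s
      filter_upwards [h1.eventually hχ.2.2.eventually_nhds] with δ hδ
      have h2 : Tendsto (fun s' : CSpace d => (-(2 * δ * t)) • s') (𝓝 s) (𝓝 ((-(2 * δ * t)) • s)) :=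
        Continuous.tendsto (by fun_prop) s
      exact h2.eventually hδ
    refine tendsto_const_nhds.congr' ?_
    filter_upwards [hloc] with δ hδ
    have h3 : (amplitude t a x fun _ => 1) =ᶠ[𝓝 s]
        amplitude t a x fun s => χ ((-(2 * δ * t)) • s) := by
      filter_upwards [hδ] with s' hs'
      rw [amplitude, amplitude, hs']
    rw [(iterate_transOp_congr h3 _).eq_of_nhds]

/-- The pointwise bound for the quantization of a symbol vanishing to third order. -/
theorem exists_norm_weylValue_le (d : ℕ) :
    ∃ C : ℝ, 0 ≤ C ∧ ∀ {h t A : ℝ} {a : RSpace d × RSpace d → ℂ} {u : CSpace d → ℂ}, 0 < t →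
      t ^ 2 = h → ContDiff ℝ ∞ a → ScaledBound (2 * d + 4) t A a → MemH h u → ∀ x : CSpace d,
      weightedAbs h (weylValue t a u) x ≤ C * A * (t + ‖x‖) ^ 3 *
        ∫ s, decay s * weightedAbs h u (x + (2 * t) • s) := by
  obtain ⟨C, hC, hT⟩ := exists_norm_iterate_amplitude_le d
  refine ⟨(Real.pi)⁻¹ ^ d * C, by positivity, fun {h t A a u} ht hth ha hA hu x => ?_⟩
  have hb : ‖∫ s, transOp^[2 * d + 4] (amplitude t a x fun _ => 1) s * weylFactor t x u s‖
      ≤ ∫ s, C * (1 * (A * (t + ‖x‖) ^ 3)) * Real.exp (Phi0 x / h) *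
          (decay s * weightedAbs h u (x + (2 * t) • s)) := by
    refine norm_integral_le_of_norm_le
      ((integrable_decay_mul_weightedAbs ht hu x).const_mul _) (Eventually.of_forall fun s => ?_)
    rw [norm_mul, norm_weylFactor_eq u ht hth]
    have hb := hT (s := s) (x := x) ha ht hA contDiff_const fun i _ => norm_iteratedFDeriv_one_le i s
    have hw := weightedAbs_nonneg h u (x + (2 * t) • s)
    calc _ ≤ C * (1 * (A * (t + ‖x‖) ^ 3)) * decay s *
          (Real.exp (Phi0 x / h) * weightedAbs h u (x + (2 * t) • s)) := by gcongr
      _ = _ := by ring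
  rw [integral_const_mul] at hb
  have hexp : Real.exp (-(Phi0 x / h)) * Real.exp (Phi0 x / h) = 1 := by
    rw [← Real.exp_add, neg_add_cancel, Real.exp_zero]
  rw [weightedAbs, weylValue, norm_mul, norm_pow, norm_inv, Complex.norm_real,
    Real.norm_of_nonneg Real.pi_pos.le]
  calc _ ≤ Real.exp (-(Phi0 x / h)) * ((Real.pi)⁻¹ ^ d *
        (C * (1 * (A * (t + ‖x‖) ^ 3)) * Real.exp (Phi0 x / h) *
          ∫ s, decay s * weightedAbs h u (x + (2 * t) • s))) := by gcongr
    _ = (Real.exp (-(Phi0 x / h)) * Real.exp (Phi0 x / h)) * ((Real.pi)⁻¹ ^ d *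
        C * A * (t + ‖x‖) ^ 3 * ∫ s, decay s * weightedAbs h u (x + (2 * t) • s)) := by ring
    _ = _ := by rw [hexp, one_mul]

/-! ### The weighted estimate -/

/-- Young's inequality in `L²`, for averages of translates `g (x + c s)`. -/
theorem lintegral_sq_lintegral_mul_translate_le {d : ℕ} {k g : CSpace d → ENNReal}
    (hk : Measurable k) (hg : Measurable g) (c : ℝ) :
    ∫⁻ x, (∫⁻ s, k s * g (x + c • s)) ^ 2 ≤ (∫⁻ s, k s) ^ 2 * ∫⁻ x, g x ^ 2 := by
  have hhalf : ∀ a : ENNReal, a ^ (1 / 2 : ℝ) * a ^ (1 / 2 : ℝ) = a := fun a => by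
    rw [← ENNReal.rpow_add_of_nonneg _ _ (by norm_num) (by norm_num)]; norm_num
  have hm : ∀ x, Measurable fun s : CSpace d => g (x + c • s) := fun x =>
    hg.comp (Continuous.measurable (by fun_prop))
  have hcs : ∀ x, (∫⁻ s, k s * g (x + c • s)) ^ 2
      ≤ (∫⁻ s, k s) * ∫⁻ s, k s * g (x + c • s) ^ 2 := by
    intro x
    have h := ENNReal.lintegral_mul_le_Lp_mul_Lq volume Real.HolderConjugate.two_two
      (f := fun s => k s ^ (1 / 2 : ℝ)) (g := fun s => k s ^ (1 / 2 : ℝ) * g (x + c • s))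
      (hk.pow_const _).aemeasurable ((hk.pow_const _).mul (hm x)).aemeasurable
    have e1 : ∀ s, (k s ^ (1 / 2 : ℝ)) ^ (2 : ℝ) = k s := fun s => by
      rw [← ENNReal.rpow_mul]; norm_num
    have e2 : ∀ s, (k s ^ (1 / 2 : ℝ) * g (x + c • s)) ^ (2 : ℝ) = k s * g (x + c • s) ^ 2 :=
      fun s => by
        rw [ENNReal.mul_rpow_of_nonneg _ _ (by norm_num), e1]
        norm_num
    have e3 : ∀ s, ((fun s => k s ^ (1 / 2 : ℝ)) * fun s => k s ^ (1 / 2 : ℝ) * g (x + c • s)) s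
        = k s * g (x + c • s) := fun s => by
      simp only [Pi.mul_apply]
      rw [← mul_assoc, hhalf]
    simp only [e1, e2, e3] at h
    calc (∫⁻ s, k s * g (x + c • s)) ^ 2 ≤ _ := pow_le_pow_left' h 2
      _ = _ := by rw [mul_pow, sq, sq, hhalf, hhalf]
  calc ∫⁻ x, (∫⁻ s, k s * g (x + c • s)) ^ 2
      ≤ ∫⁻ x, (∫⁻ s, k s) * ∫⁻ s, k s * g (x + c • s) ^ 2 := lintegral_mono hcs
    _ = (∫⁻ s, k s) * ∫⁻ x, ∫⁻ s, k s * g (x + c • s) ^ 2 := by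
        refine lintegral_const_mul _ (Measurable.lintegral_prod_right' (f := fun q :
          CSpace d × CSpace d => k q.2 * g (q.1 + c • q.2) ^ 2) ?_)
        exact (hk.comp measurable_snd).mul
          ((hg.comp (Continuous.measurable (by fun_prop))).pow_const 2)
    _ = (∫⁻ s, k s) * ∫⁻ s, ∫⁻ x, k s * g (x + c • s) ^ 2 := by
        rw [lintegral_lintegral_swap]
        exact ((hk.comp measurable_snd).mul
          ((hg.comp (Continuous.measurable (by fun_prop))).pow_const 2)).aemeasurable
    _ = (∫⁻ s, k s) * ((∫⁻ s, k s) * ∫⁻ x, g x ^ 2) := by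
        congr 1
        rw [← lintegral_mul_const _ hk]
        refine lintegral_congr fun s => ?_
        have hm' : Measurable fun x : CSpace d => g (x + c • s) ^ 2 :=
          (hg.comp (measurable_add_const _)).pow_const 2
        rw [lintegral_const_mul _ hm', lintegral_add_right_eq_self fun x => g x ^ 2]
    _ = _ := by ring

theorem exists_isCutoff (d : ℕ) : ∃ χ : CSpace d → ℂ, IsCutoff χ := by
  let f : ContDiffBump (0 : CSpace d) := ⟨1, 2, one_pos, one_lt_two⟩
  refine ⟨fun x => (f x : ℂ), Complex.ofRealCLM.contDiff.comp f.contDiff,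
    f.hasCompactSupport.comp_left Complex.ofReal_zero, ?_⟩
  filter_upwards [f.eventuallyEq_one] with x hx
  simp [hx]

theorem stronglyMeasurable_weylValue {d : ℕ} {h t A : ℝ} (ht : 0 < t) (hth : t ^ 2 = h)
    {a : RSpace d × RSpace d → ℂ} (ha : ContDiff ℝ ∞ a) (hA : ScaledBound (2 * d + 4) t A a)
    {u : CSpace d → ℂ} (hu : MemH h u) : StronglyMeasurable (weylValue t a u) := by
  obtain ⟨χ, hχ⟩ := exists_isCutoff d
  have hlim : Tendsto (fun n : ℕ => (1 : ℝ) / (n + 1)) atTop (𝓝[>] 0) :=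
    tendsto_nhdsWithin_iff.mpr ⟨tendsto_one_div_add_atTop_nhds_zero_nat,
      Eventually.of_forall fun n => mem_Ioi.mpr Nat.one_div_pos_of_nat⟩
  refine stronglyMeasurable_of_tendsto atTop
    (f := fun (n : ℕ) x => truncatedWeyl h (fbiSymbol a) u χ (1 / (n + 1)) x) (fun n => ?_)
    (tendsto_pi_nhds.mpr fun x => (isWeyl_weylValue ht hth ha hA hu χ hχ x).comp hlim)
  simp only [truncatedWeyl_eq ht hth]
  refine StronglyMeasurable.const_mul (StronglyMeasurable.integral_prod_right
    (f := fun x s => amplitude t a x (fun s => χ ((-(2 * (1 / ((n : ℝ) + 1)) * t)) • s)) s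
      * weylFactor t x u s) (Continuous.stronglyMeasurable ?_)) _
  have c1 := hχ.1.continuous
  have c2 := ha.continuous
  have c3 := hu.1.continuous
  have c4 : Continuous fun q : CSpace d × CSpace d => weylExponent t q.1 q.2 := by
    unfold weylExponent
    fun_prop
  exact ((c1.comp (by fun_prop)).mul (c2.comp ((phaseMap d).continuous.comp (by fun_prop)))).mul
    (c4.cexp.mul (c3.comp (by fun_prop)))

/-- Linearity of the quantization in the symbol. -/
theorem IsWeyl.of_sub {d : ℕ} {h t : ℝ} (ht : 0 < t) (hth : t ^ 2 = h)
    {a b : RSpace d × RSpace d → ℂ} (ha : Continuous a) (hb : Continuous b) {u v w : CSpace d → ℂ}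
    (hu : Differentiable ℂ u) (hv : IsWeyl h (fbiSymbol a) u v)
    (hw : IsWeyl h (fbiSymbol fun X => a X - b X) u w) :
    IsWeyl h (fbiSymbol b) u fun x => v x - w x := by
  intro χ hχ x
  refine ((hv χ hχ x).sub (hw χ hχ x)).congr' ?_
  filter_upwards [self_mem_nhdsWithin] with δ hδ
  have hδ0 : 0 < δ := hδ
  have hcomp : HasCompactSupport fun s : CSpace d => χ ((-(2 * δ * t)) • s) :=
    hχ.2.1.comp_smul (by have := mul_pos hδ0 ht; nlinarith)
  have hi : ∀ f : RSpace d × RSpace d → ℂ, Continuous f → Integrable fun s =>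
      amplitude t f x (fun s => χ ((-(2 * δ * t)) • s)) s * weylFactor t x u s := fun f hf =>
    Continuous.integrable_of_hasCompactSupport
      (((hχ.1.continuous.comp (by fun_prop)).mul
        (hf.comp ((phaseMap d).continuous.comp (by fun_prop)))).mul (continuous_weylFactor hu t x))
      hcomp.mul_right.mul_right
  rw [truncatedWeyl_eq ht hth, truncatedWeyl_eq ht hth, truncatedWeyl_eq ht hth, ← mul_sub,
    ← integral_sub (hi a ha) (hi (fun X => a X - b X) (ha.sub hb))]
  congr 1
  refine integral_congr_ae (Eventually.of_forall fun s => ?_)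
  simp only [amplitude]
  ring

/-- The weighted estimate on a ball for symbols vanishing to third order. -/
theorem exists_eLpNorm_indicator_weylValue_le (d : ℕ) :
    ∃ C : ℝ, 0 ≤ C ∧ ∀ {h t A ε : ℝ} {a : RSpace d × RSpace d → ℂ} {u : CSpace d → ℂ}, 0 < t →
      t ^ 2 = h → t ≤ ε → ContDiff ℝ ∞ a → ScaledBound (2 * d + 4) t A a → MemH h u →
      eLpNorm ({x : CSpace d | ‖x‖ ≤ ε}.indicator (weylValue t a u)) 2 (weightedMeasure d h)
        ≤ ENNReal.ofReal (C * A * ε ^ 3) * eLpNorm u 2 (weightedMeasure d h) := by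
  obtain ⟨C, hC, hb⟩ := exists_norm_weylValue_le d
  have hI0 : 0 ≤ ∫ s : CSpace d, decay s := integral_nonneg decay_nonneg
  refine ⟨C * 8 * ∫ s : CSpace d, decay s, by positivity,
    fun {h t A ε a u} ht hth htε ha hA hu => ?_⟩
  have hA0 := hA.nonneg ht
  have hε : 0 ≤ ε := ht.le.trans htε
  set f := {x : CSpace d | ‖x‖ ≤ ε}.indicator (weylValue t a u) with hf
  set M : ℝ := C * 8 * A * ε ^ 3 with hM
  have hM0 : 0 ≤ M := by positivity
  have hwm : Measurable (weightedAbs h u) := (continuous_weightedAbs hu.1.continuous h).measurable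
  have hint : ∀ x, ENNReal.ofReal (∫ s, decay s * weightedAbs h u (x + (2 * t) • s))
      = ∫⁻ s, ENNReal.ofReal (decay s) * ‖weightedAbs h u (x + (2 * t) • s)‖ₑ := by
    intro x
    rw [ofReal_integral_eq_lintegral_ofReal (integrable_decay_mul_weightedAbs ht hu x)
      (Eventually.of_forall fun s => mul_nonneg (decay_nonneg s) (weightedAbs_nonneg _ _ _))]
    refine lintegral_congr fun s => ?_
    rw [ENNReal.ofReal_mul (decay_nonneg s), Real.enorm_of_nonneg (weightedAbs_nonneg _ _ _)]
  have hpt : ∀ x, ‖weightedAbs h f x‖ₑ ≤ ENNReal.ofReal M *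
      ∫⁻ s, ENNReal.ofReal (decay s) * ‖weightedAbs h u (x + (2 * t) • s)‖ₑ := by
    intro x
    rw [← hint, ← ENNReal.ofReal_mul hM0, Real.enorm_of_nonneg (weightedAbs_nonneg _ _ _)]
    refine ENNReal.ofReal_le_ofReal ?_
    have hJ : 0 ≤ ∫ s, decay s * weightedAbs h u (x + (2 * t) • s) :=
      integral_nonneg fun s => mul_nonneg (decay_nonneg s) (weightedAbs_nonneg _ _ _)
    by_cases hx : ‖x‖ ≤ ε
    · have e : weightedAbs h f x = weightedAbs h (weylValue t a u) x := by
        rw [weightedAbs, weightedAbs, hf, indicator_of_mem (by exact hx)]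
      rw [e]
      refine (hb ht hth ha hA hu x).trans ?_
      have h8 : (t + ‖x‖) ^ 3 ≤ 8 * ε ^ 3 :=
        calc (t + ‖x‖) ^ 3 ≤ (2 * ε) ^ 3 := by
              have := norm_nonneg x
              gcongr
              linarith
          _ = 8 * ε ^ 3 := by ring
      calc _ ≤ C * A * (8 * ε ^ 3) * ∫ s, decay s * weightedAbs h u (x + (2 * t) • s) := by gcongr
        _ = _ := by rw [hM]; ring
    · have e : weightedAbs h f x = 0 := by
        rw [weightedAbs, hf, indicator_of_notMem (by exact hx), norm_zero, mul_zero]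
      rw [e]
      positivity
  have hD : ∫⁻ s : CSpace d, ENNReal.ofReal (decay s) = ENNReal.ofReal (∫ s : CSpace d, decay s) :=
    (ofReal_integral_eq_lintegral_ofReal integrable_decay
      (Eventually.of_forall decay_nonneg)).symm
  have hy := lintegral_sq_lintegral_mul_translate_le
    (k := fun s : CSpace d => ENNReal.ofReal (decay s)) (g := fun y => ‖weightedAbs h u y‖ₑ)
    continuous_decay.measurable.ennreal_ofReal hwm.enorm (2 * t)
  have hsq : ∫⁻ x, ‖weightedAbs h f x‖ₑ ^ 2
      ≤ ENNReal.ofReal (M * ∫ s : CSpace d, decay s) ^ 2 * ∫⁻ y, ‖weightedAbs h u y‖ₑ ^ 2 := by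
    calc ∫⁻ x, ‖weightedAbs h f x‖ₑ ^ 2
        ≤ ∫⁻ x, ENNReal.ofReal M ^ 2 *
          (∫⁻ s, ENNReal.ofReal (decay s) * ‖weightedAbs h u (x + (2 * t) • s)‖ₑ) ^ 2 := by
          refine lintegral_mono fun x => ?_
          rw [← mul_pow]
          exact pow_le_pow_left' (hpt x) 2
      _ = ENNReal.ofReal M ^ 2 * ∫⁻ x,
          (∫⁻ s, ENNReal.ofReal (decay s) * ‖weightedAbs h u (x + (2 * t) • s)‖ₑ) ^ 2 :=
          lintegral_const_mul' _ _ (ENNReal.pow_ne_top ENNReal.ofReal_ne_top)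
      _ ≤ ENNReal.ofReal M ^ 2 * ((∫⁻ s : CSpace d, ENNReal.ofReal (decay s)) ^ 2 *
          ∫⁻ y, ‖weightedAbs h u y‖ₑ ^ 2) := by gcongr
      _ = _ := by rw [hD, ENNReal.ofReal_mul hM0, mul_pow]; ring
  rw [eLpNorm_weightedMeasure, eLpNorm_weightedMeasure]
  calc (∫⁻ x, ‖weightedAbs h f x‖ₑ ^ 2) ^ (1 / 2 : ℝ)
      ≤ (ENNReal.ofReal (M * ∫ s : CSpace d, decay s) ^ 2 *
          ∫⁻ y, ‖weightedAbs h u y‖ₑ ^ 2) ^ (1 / 2 : ℝ) := by gcongr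
    _ = _ := by
        rw [ENNReal.mul_rpow_of_nonneg _ _ (by norm_num), ← ENNReal.rpow_natCast,
          ← ENNReal.rpow_mul]
        norm_num
        congr 2
        rw [hM]
        ring

theorem exists_scaledBound {d : ℕ} {a : RSpace d × RSpace d → ℂ} (n : ℕ) {T : Set ℝ}
    (hT : ∀ t ∈ T, 0 ≤ t)
    (h : ∀ k, ∃ C : ℝ, ∀ t ∈ T, ∀ X, t ^ k * ‖iteratedFDeriv ℝ k a X‖ ≤ C * (t + ‖X‖) ^ 3) :
    ∃ A : ℝ, 0 ≤ A ∧ ∀ t ∈ T, ScaledBound n t A a := by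
  choose C hC using h
  refine ⟨∑ k ∈ Finset.range (n + 1), |C k|, Finset.sum_nonneg fun _ _ => abs_nonneg _,
    fun t ht k hk X => (hC k t ht X).trans ?_⟩
  have h1 : C k ≤ ∑ k ∈ Finset.range (n + 1), |C k| :=
    (le_abs_self _).trans (Finset.single_le_sum (f := fun k => |C k|) (fun _ _ => abs_nonneg _)
      (Finset.mem_range.mpr (by omega)))
  have := hT t ht
  gcongr

/-- For fixed `t`, symbols in `S(1)` satisfy the scaled bounds, with a constant depending on `t`. -/
theorem IsSymbolS1.exists_scaledBound {d : ℕ} {a : RSpace d × RSpace d → ℂ} (ha : IsSymbolS1 a)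
    (n : ℕ) {t : ℝ} (ht : 0 < t) : ∃ A : ℝ, ScaledBound n t A a := by
  obtain ⟨A, -, hA⟩ := Bargmann.exists_scaledBound (a := a) n (T := {t}) (by
    rintro _ rfl; exact ht.le) fun k => by
      obtain ⟨C, hC⟩ := ha.2 k
      refine ⟨t ^ k * C / t ^ 3, ?_⟩
      rintro _ rfl X
      have hC0 : 0 ≤ C := (norm_nonneg _).trans (hC 0)
      rw [div_mul_eq_mul_div, le_div_iff₀ (by positivity)]
      gcongr
      · exact hC X
      · linarith [norm_nonneg X]
  exact ⟨A, hA t rfl⟩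

end

end Bargmann

theorem mainTheorem6 (d : ℕ)
    (p : Bargmann.RSpace d × Bargmann.RSpace d → ℂ)
    (q : QuadraticMap ℝ (Bargmann.RSpace d × Bargmann.RSpace d) ℂ)
    (hpq : Bargmann.IsDoublyCharacteristic p q) :
    ∃ C : ℝ, 0 < C ∧ ∀ h : ℝ, 0 < h → h ≤ 1 →
      ∀ u : Bargmann.CSpace d → ℂ, Bargmann.MemH h u →
        ∃ Pu Qu : Bargmann.CSpace d → ℂ,
          Bargmann.IsWeyl h (Bargmann.fbiSymbol p) u Pu ∧
          Bargmann.IsWeyl h (Bargmann.fbiSymbol q) u Qu ∧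
          ∀ ε : ℝ, h ^ (1 / 2 : ℝ) ≤ ε →
            MemLp ({x : Bargmann.CSpace d | ‖x‖ ≤ ε}.indicator fun x => Pu x - Qu x) 2
              (Bargmann.weightedMeasure d h) ∧
            eLpNorm ({x : Bargmann.CSpace d | ‖x‖ ≤ ε}.indicator fun x => Pu x - Qu x) 2
                (Bargmann.weightedMeasure d h) ≤
              ENNReal.ofReal (C * ε ^ 3) *
                eLpNorm u 2 (Bargmann.weightedMeasure d h) := by
  open Bargmann in
  obtain ⟨C, hC, hL2⟩ := exists_eLpNorm_indicator_weylValue_le d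
  obtain ⟨A, hA0, hA⟩ := exists_scaledBound (2 * d + 4) (T := Ioc 0 1) (fun t ht => ht.1.le)
    fun k => (hpq.exists_scaled_bound_sub k).imp fun _ hC t ht => hC t ht.1 ht.2
  have hp := hpq.symbol.1
  have hq := contDiff_quadraticMap q
  refine ⟨C * A + 1, by positivity, fun h hh hh1 u hu => ?_⟩
  set t : ℝ := h ^ (1 / 2 : ℝ) with htdef
  have ht : 0 < t := Real.rpow_pos_of_pos hh _
  have hth : t ^ 2 = h := by
    rw [htdef, ← Real.sqrt_eq_rpow, Real.sq_sqrt hh.le]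
  have ht1 : t ≤ 1 := Real.rpow_le_one hh.le hh1 (by norm_num)
  obtain ⟨Ap, hAp⟩ := hpq.symbol.exists_scaledBound (2 * d + 4) ht
  have hAr := hA t ⟨ht, ht1⟩
  have hr : ContDiff ℝ ∞ fun X => p X - q X := hp.sub hq
  have hPu := isWeyl_weylValue ht hth hp hAp hu
  have hRu := isWeyl_weylValue ht hth hr hAr hu
  refine ⟨weylValue t p u, fun x => weylValue t p u x - weylValue t (fun X => p X - q X) u x, hPu,
    IsWeyl.of_sub ht hth hp.continuous hq.continuous hu.1 hPu hRu, fun ε hε => ?_⟩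
  simp only [sub_sub_cancel]
  have hbound := hL2 ht hth hε hr hAr hu
  have hε0 : 0 ≤ ε := ht.le.trans hε
  have hle : eLpNorm ({x : CSpace d | ‖x‖ ≤ ε}.indicator (weylValue t (fun X => p X - q X) u)) 2
      (weightedMeasure d h)
      ≤ ENNReal.ofReal ((C * A + 1) * ε ^ 3) * eLpNorm u 2 (weightedMeasure d h) := by
    refine hbound.trans ?_
    gcongr
    linarith
  refine ⟨⟨?_, hle.trans_lt (ENNReal.mul_lt_top ENNReal.ofReal_lt_top hu.2.eLpNorm_lt_top)⟩, hle⟩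
  exact ((stronglyMeasurable_weylValue ht hth hr hAr hu).indicator
    (isClosed_le continuous_norm continuous_const).measurableSet).aestronglyMeasurable
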